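/- Let $T>0$, let $W=(W_t)_{t\in[0,T]}$ be a standard $q$-dimensional Brownian motion on a filtered probability space, with probability $\mathbb P$, and let $X$ be an adapted solution with continuous paths of the path-dependent stochastic differential equation $$dX_t=b(t,X^t)\,dt+\sigma(t,X^t)\,dW_t,\qquad X_0=x\in\mathbb R^d,\qquad t\in[0,T],$$ where $X^t=(X_{t\wedge s})_{s\in[0,T]}$ and where $b:[0,T]\times C([0,T],\mathbb R^d)\to\mathbb R^d$ and $\sigma:[0,T]\times C([0,T],\mathbb R^d)\to\mathcal M(d,q)$ are measurable with respect to the canonical predictable $\sigma$-field, $b(\cdot,0)$ and $\sigma(\cdot,0)$ are continuous, and there is a constant $C_{b,\sigma}$ with $$|b(t,y)-b(t,x)|+\|\sigma(t,y)-\sigma(t,x)\|\le C_{b,\sigma}\|x-y\|_\infty\qquad\text{for all }t\in[0,T],\ x,y\in C([0,T],\mathbb R^d).$$ Let $F:C([0,T],\mathbb R^d)\to\mathbb R$ be a Borel functional with $\mathbb E[|F(X)|^{2+\delta}]<+\infty$ for some $\delta>0$ and $\mathbb P(F^2(X)>0)>0$. Write $L^2_{T,q}=L^2([0,T],\mathbb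 R^q)$ and, for $\theta\in L^2_{T,q}$, $$\Phi(\theta)=-\int_0^T\langle\theta_s,dW_s\rangle+\tfrac12\|\theta\|^2_{L^2_{T,q}},\qquad Q(\theta)=\mathbb E\big[F^2(X)e^{\Phi(\theta)}\big],$$ where the stochastic integral is the Wiener integral. Then: 1. $Q$ is finite and strictly convex on $L^2_{T,q}$, and for every finite-dimensional subspace $E$ of $L^2_{T,q}$, $$\lim_{\|\theta\|_{L^2_{T,q}}\to+\infty}Q(\theta)=\lim_{\|\theta\|_{L^2_{T,q}}\to+\infty,\ \theta\in E}Q(\theta)=+\infty.$$ 2. For every $r\in[1,\infty)$, $\Phi$ is twice Fréchet differentiable as a map from $L^2_{T,q}$ to $L^r(\mathbb P)$, and for all $\theta,\psi,\phi\in L^2_{T,q}$, almost surely, $$\langle D\Phi(\theta),\psi\rangle=-\int_0^T\langle\psi_s,dW_s\rangle+\int_0^T\langle\theta_s,\psi_s\rangle\,ds,\qquad (D^2\Phi(\theta)\psi,\phi)=\int_0^T\langle\phi_s,\psi_s\rangle\,ds.$$ 3. $Q$ is twice Fréchet differentiable at every $\theta\in L^2_{T,q}$, and for all $\psi,\phi\in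 L^2_{T,q}$ (the random variables on the right being integrable) $$\langle DQ(\theta),\psi\rangle=\mathbb E\big[F^2(X)e^{\Phi(\theta)}\langle D\Phi(\theta),\psi\rangle\big],$$ $$(D^2Q(\theta)\psi,\phi)=\mathbb E\big[F^2(X)e^{\Phi(\theta)}\big(\langle D\Phi(\theta),\psi\rangle\langle D\Phi(\theta),\phi\rangle+(D^2\Phi(\theta)\psi,\phi)\big)\big].$$ -/

import Mathlib

open MeasureTheory ProbabilityTheory Filter Topology
open scoped ENNReal

/-- The time interval `[0, T]`. -/
abbrev TimeInterval (T : ℝ) : Type := Set.Icc (0 : ℝ) T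

/-- Lebesgue measure on `[0, T]`. -/
noncomputable def timeMeasure (T : ℝ) : Measure (TimeInterval T) :=
  Measure.comap (Subtype.val : TimeInterval T → ℝ) volume

/-- The Hilbert space `L²([0, T], ℝ^q)`. -/
abbrev TimeL2 (T : ℝ) (q : ℕ) : Type :=
  Lp (EuclideanSpace ℝ (Fin q)) 2 (timeMeasure T)

/-- The path space `C([0, T], ℝ^d)`, with the supremum norm. -/
abbrev PathSpace (T : ℝ) (d : ℕ) : Type := C(TimeInterval T, EuclideanSpace ℝ (Fin d))

/-- The path space carries its Borel `σ`-algebra. -/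
instance pathSpaceMeasurableSpace (T : ℝ) (d : ℕ) : MeasurableSpace (PathSpace T d) := borel _

instance pathSpaceBorelSpace (T : ℝ) (d : ℕ) : BorelSpace (PathSpace T d) := ⟨rfl⟩

/-- The canonical filtration of the path space: at time `t`, the `σ`-algebra generated by the
coordinate maps `x ↦ x s`, `s ≤ t`. -/
noncomputable def canonicalFiltration (T : ℝ) (d : ℕ) :
    Filtration (TimeInterval T) (pathSpaceMeasurableSpace T d) :=
  Filtration.natural (fun t (x : PathSpace T d) => x t)
    (fun t => (continuous_eval_const t).stronglyMeasurable)

/-- The stopped path `x^t : s ↦ x (t ∧ s)`. -/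
def stoppedPath {T : ℝ} {d : ℕ} (t : TimeInterval T) (x : PathSpace T d) : PathSpace T d :=
  x.comp ⟨fun s => min t s, by fun_prop⟩

/-- `W` is a standard `q`-dimensional Brownian motion on `[0, T]` with respect to the
filtration `𝓕`, under `P`. -/
structure IsBrownianMotion {Ω : Type*} {mΩ : MeasurableSpace Ω} {T : ℝ} {q : ℕ}
    (P : Measure Ω) (𝓕 : Filtration (TimeInterval T) mΩ)
    (W : TimeInterval T → Ω → EuclideanSpace ℝ (Fin q)) : Prop where
  adapted : ∀ t, Measurable[𝓕 t] (W t)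
  initial : ∀ t : TimeInterval T, (t : ℝ) = 0 → ∀ᵐ ω ∂P, W t ω = 0
  continuous_paths : ∀ᵐ ω ∂P, Continuous (fun t => W t ω)
  law_increment : ∀ s t : TimeInterval T, s ≤ t →
    HasLaw (fun ω => W t ω - W s ω)
      (multivariateGaussian 0 (((t : ℝ) - (s : ℝ)) • (1 : Matrix (Fin q) (Fin q) ℝ))) P
  indep_increment : ∀ s t : TimeInterval T, s ≤ t →
    Indep (𝓕 s) (MeasurableSpace.comap (fun ω => W t ω - W s ω) inferInstance) P

/-- A deterministic step function `∑ i, 1_{(t i, t (i + 1)]} a i` on `[0, T]` with values in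
`ℝ^q`. -/
structure StepFunction (T : ℝ) (q : ℕ) where
  n : ℕ
  t : Fin (n + 1) → TimeInterval T
  monotone_t : Monotone t
  a : Fin n → EuclideanSpace ℝ (Fin q)

namespace StepFunction

variable {T : ℝ} {q : ℕ}

/-- The value of a step function. -/
noncomputable def eval (h : StepFunction T q) (s : TimeInterval T) : EuclideanSpace ℝ (Fin q) :=
  ∑ i : Fin h.n, (Set.Ioc (h.t i.castSucc) (h.t i.succ)).indicator (fun _ => h.a i) s

/-- The integral `∑ i, ⟨a i, W (t (i + 1)) - W (t i)⟩` of a step function. -/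
noncomputable def integral {Ω : Type*} (h : StepFunction T q)
    (W : TimeInterval T → Ω → EuclideanSpace ℝ (Fin q)) (ω : Ω) : ℝ :=
  ∑ i : Fin h.n, inner ℝ (h.a i) (W (h.t i.succ) ω - W (h.t i.castSucc) ω)

end StepFunction

/-- `Y` is (a version of) the Wiener integral `∫₀ᵀ ⟨θ_s, dW_s⟩`: the limit in `L²(P)` of the
integrals of step functions that converge to `θ` in `L²([0, T], ℝ^q)`. -/
def IsWienerIntegral {Ω : Type*} [MeasurableSpace Ω] {T : ℝ} {q : ℕ} (P : Measure Ω)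
    (W : TimeInterval T → Ω → EuclideanSpace ℝ (Fin q)) (θ : TimeL2 T q) (Y : Ω → ℝ) : Prop :=
  MemLp Y 2 P ∧ ∃ h : ℕ → StepFunction T q,
    Tendsto (fun n => eLpNorm (fun s => (h n).eval s - θ s) 2 (timeMeasure T)) atTop (𝓝 0) ∧
    Tendsto (fun n => eLpNorm (fun ω => (h n).integral W ω - Y ω) 2 P) atTop (𝓝 0)

open Classical in
/-- A version of the Wiener integral `∫₀ᵀ ⟨θ_s, dW_s⟩`. When `W` is a Brownian motion, the Wiener
integral exists for every `θ` and is unique up to `P`-null sets. -/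
noncomputable def wienerIntegral {Ω : Type*} [MeasurableSpace Ω] {T : ℝ} {q : ℕ} (P : Measure Ω)
    (W : TimeInterval T → Ω → EuclideanSpace ℝ (Fin q)) (θ : TimeL2 T q) : Ω → ℝ :=
  if h : ∃ Y : Ω → ℝ, IsWienerIntegral P W θ Y then h.choose else 0

/-- A simple predictable process `∑ i, 1_{(t i, t (i + 1)]} ξ i` with values in the `d × q`
matrices, where each `ξ i` is bounded and `𝓕 (t i)`-measurable. -/
structure SimplePredictable {Ω : Type*} {mΩ : MeasurableSpace Ω} {T : ℝ}
    (𝓕 : Filtration (TimeInterval T) mΩ) (q d : ℕ) where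
  n : ℕ
  t : Fin (n + 1) → TimeInterval T
  monotone_t : Monotone t
  ξ : Fin n → Ω → (EuclideanSpace ℝ (Fin q) →L[ℝ] EuclideanSpace ℝ (Fin d))
  measurable_ξ : ∀ i, Measurable[𝓕 (t i.castSucc)] (ξ i)
  bounded_ξ : ∃ C : ℝ, ∀ i ω, ‖ξ i ω‖ ≤ C

namespace SimplePredictable

variable {Ω : Type*} {mΩ : MeasurableSpace Ω} {T : ℝ} {𝓕 : Filtration (TimeInterval T) mΩ}
  {q d : ℕ}

/-- The value of a simple predictable process. -/
noncomputable def eval (V : SimplePredictable 𝓕 q d) (s : TimeInterval T) (ω : Ω) :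
    EuclideanSpace ℝ (Fin q) →L[ℝ] EuclideanSpace ℝ (Fin d) :=
  ∑ i : Fin V.n, (Set.Ioc (V.t i.castSucc) (V.t i.succ)).indicator (fun _ => V.ξ i ω) s

/-- The integral `∫₀ᵗ V_s dW_s = ∑ i, ξ i (W (t (i + 1) ∧ t) - W (t i ∧ t))`. -/
noncomputable def integral (V : SimplePredictable 𝓕 q d)
    (W : TimeInterval T → Ω → EuclideanSpace ℝ (Fin q)) (t : TimeInterval T) (ω : Ω) :
    EuclideanSpace ℝ (Fin d) :=
  ∑ i : Fin V.n, V.ξ i ω (W (min (V.t i.succ) t) ω - W (min (V.t i.castSucc) t) ω)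

end SimplePredictable

/-- `Y` is (a version of) the Itô integral process `t ↦ ∫₀ᵗ H_s dW_s`: there are simple
predictable processes `V n` with `∫₀ᵀ ‖V n - H‖² ds → 0` in probability such that, for every
`t ∈ [0, T]`, the integrals `∫₀ᵗ V n dW` converge to `Y t` in probability. -/
def IsItoIntegral {Ω : Type*} {mΩ : MeasurableSpace Ω} {T : ℝ} {q d : ℕ}
    (P : Measure Ω) (𝓕 : Filtration (TimeInterval T) mΩ)
    (W : TimeInterval T → Ω → EuclideanSpace ℝ (Fin q))
    (H : TimeInterval T → Ω → (EuclideanSpace ℝ (Fin q) →L[ℝ] EuclideanSpace ℝ (Fin d)))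
    (Y : TimeInterval T → Ω → EuclideanSpace ℝ (Fin d)) : Prop :=
  ∃ V : ℕ → SimplePredictable 𝓕 q d,
    (∀ ε : ℝ≥0∞, 0 < ε → Tendsto
      (fun n => P {ω | ε ≤ ∫⁻ s, ‖(V n).eval s ω - H s ω‖ₑ ^ 2 ∂(timeMeasure T)}) atTop (𝓝 0)) ∧
    ∀ t, TendstoInMeasure P (fun n ω => (V n).integral W t ω) atTop (Y t)

/-- The standing assumptions on the coefficients `b : [0, T] × C([0, T], ℝ^d) → ℝ^d` and
`σ : [0, T] × C([0, T], ℝ^d) → M(d, q)`: both are measurable for the canonical predictable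
`σ`-algebra, `b(·, 0)` and `σ(·, 0)` are continuous, and both are Lipschitz continuous in the path
for the supremum norm, uniformly in time. A `d × q` matrix is viewed as a linear map
`ℝ^q → ℝ^d`. -/
structure IsAdmissibleCoefficients {T : ℝ} [Fact (0 ≤ T)] {q d : ℕ}
    (b : TimeInterval T → PathSpace T d → EuclideanSpace ℝ (Fin d))
    (σ : TimeInterval T → PathSpace T d →
      (EuclideanSpace ℝ (Fin q) →L[ℝ] EuclideanSpace ℝ (Fin d))) : Prop where
  predictable_b : IsStronglyPredictable (canonicalFiltration T d) b
  predictable_σ : IsStronglyPredictable (canonicalFiltration T d) σ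
  continuous_b_zero : Continuous (fun t => b t 0)
  continuous_σ_zero : Continuous (fun t => σ t 0)
  lipschitz : ∃ C : ℝ, ∀ t x y, ‖b t y - b t x‖ + ‖σ t y - σ t x‖ ≤ C * ‖x - y‖

/-- `X` is a solution, adapted to `𝓕` and with continuous paths, of the stochastic differential
equation `dX_t = b(t, X^t) dt + σ(t, X^t) dW_t`, `X_0 = x₀`, on `[0, T]`. -/
structure IsSolution {Ω : Type*} {mΩ : MeasurableSpace Ω} {T : ℝ} {q d : ℕ}
    (P : Measure Ω) (𝓕 : Filtration (TimeInterval T) mΩ)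
    (W : TimeInterval T → Ω → EuclideanSpace ℝ (Fin q))
    (b : TimeInterval T → PathSpace T d → EuclideanSpace ℝ (Fin d))
    (σ : TimeInterval T → PathSpace T d →
      (EuclideanSpace ℝ (Fin q) →L[ℝ] EuclideanSpace ℝ (Fin d)))
    (x₀ : EuclideanSpace ℝ (Fin d)) (X : Ω → PathSpace T d) : Prop where
  adapted : ∀ t, Measurable[𝓕 t] (fun ω => X ω t)
  initial : ∀ t : TimeInterval T, (t : ℝ) = 0 → ∀ᵐ ω ∂P, X ω t = x₀
  equation : IsItoIntegral P 𝓕 W (fun s ω => σ s (stoppedPath s (X ω)))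
    (fun t ω => X ω t - x₀ - ∫ s in Set.Iic t, b s (stoppedPath s (X ω)) ∂(timeMeasure T))

section Girsanov

variable {Ω : Type*} [MeasurableSpace Ω] {T : ℝ} {q d : ℕ} (P : Measure Ω)
  (W : TimeInterval T → Ω → EuclideanSpace ℝ (Fin q))

/-- `Φ(θ) = - ∫₀ᵀ ⟨θ_s, dW_s⟩ + ‖θ‖² / 2`. -/
noncomputable def girsanovPhi (θ : TimeL2 T q) (ω : Ω) : ℝ :=
  - wienerIntegral P W θ ω + 1 / 2 * ‖θ‖ ^ 2

/-- `⟨DΦ(θ), ψ⟩ = - ∫₀ᵀ ⟨ψ_s, dW_s⟩ + ∫₀ᵀ ⟨θ_s, ψ_s⟩ ds`. -/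
noncomputable def girsanovDPhi (θ ψ : TimeL2 T q) (ω : Ω) : ℝ :=
  - wienerIntegral P W ψ ω + ∫ s, inner ℝ (θ s) (ψ s) ∂(timeMeasure T)

/-- `(D²Φ(θ) ψ, φ) = ∫₀ᵀ ⟨φ_s, ψ_s⟩ ds`, which does not depend on `θ`. -/
noncomputable def girsanovD2Phi (ψ φ : TimeL2 T q) : ℝ :=
  ∫ s, inner ℝ (φ s) (ψ s) ∂(timeMeasure T)

/-- `Q(θ) = E[F²(X) exp(Φ(θ))]`. -/
noncomputable def girsanovQ (F : PathSpace T d → ℝ) (X : Ω → PathSpace T d)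
    (θ : TimeL2 T q) : ℝ :=
  ∫ ω, F (X ω) ^ 2 * Real.exp (girsanovPhi P W θ ω) ∂P

end Girsanov

/-! The proof rests on one property of the Wiener integral: it is a continuous linear map `J` from
`H = L²([0, T], ℝ^q)` to `L²(P)` with `E[exp (t J θ)] ≤ exp (t² ‖θ‖² / 2)`. From this alone, `J` is
continuous into every `L^r` with `r` finite, and `exp (-J (θ + φ)) - exp (-J θ) + exp (-J θ) J φ`
has `L^r` norm `O(‖φ‖²)` (`norm_expLp_add_sub_le`). Hence `θ ↦ exp (Φ θ)` is differentiable into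
`L^r`. Hölder's inequality costs a factor two in the exponent per differentiation, so two
derivatives in `L^r` use `L^{2r}` and `L^{4r}`. Since `F²(X)` lies in `L^s` with `s = 1 + δ/2 > 1`,
pairing with it is a continuous functional on `L^r` for the finite conjugate exponent `r`, and `Q`
inherits both differentials.

Strict convexity comes from the term `‖θ‖² / 2`, as `J` is linear (`ae_exp_phi_lt`). Coercivity
comes from a tangent line of the exponential, which gives `Q(θ) ≥ z exp (‖θ‖² / 2 - C ‖θ‖)` with `z
= E[F²(X)]` (`exists_le_expectation`).

To construct `J`, note that the functions `1_{(0, t]} a` in `H` and the variables `⟨a, W t⟩` in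
`L²(P)` have the same Gram matrix, so matching them extends to an isometry. Independent increments
give the exponential bound on step functions, and Fatou's lemma carries it to their limits
(`isSubgaussianMap_wienerL`). -/

/-- A continuous linear map `J` into `L²(P)` is subgaussian if every `J θ` is subgaussian with
variance proxy `‖θ‖²`. -/
def IsSubgaussianMap {Ω : Type*} {mΩ : MeasurableSpace Ω} {P : Measure Ω} {H : Type*}
    [NormedAddCommGroup H] [InnerProductSpace ℝ H] (J : H →L[ℝ] Lp ℝ 2 P) : Prop :=
  ∀ θ, HasSubgaussianMGF (J θ) (‖θ‖₊ ^ 2) P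

/-! ### Moment bounds for subgaussian maps. -/

namespace IsSubgaussianMap

variable {Ω : Type*} {mΩ : MeasurableSpace Ω} {P : Measure Ω} {H : Type*}
  [NormedAddCommGroup H] [InnerProductSpace ℝ H] {J : H →L[ℝ] Lp ℝ 2 P}

lemma memLp_exp_neg (hJ : IsSubgaussianMap J) {r : ℝ≥0∞} (hr : r ≠ ∞) (θ : H) :
    MemLp (fun ω => Real.exp (-J θ ω)) r P := by
  lift r to NNReal using hr
  simpa using (hJ θ).memLp_exp_mul (-1) r

lemma memLp (hJ : IsSubgaussianMap J) {r : ℝ≥0∞} (hr : r ≠ ∞) (θ : H) :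
    MemLp (J θ) r P := by
  lift r to NNReal using hr
  exact (hJ θ).memLp r

lemma ae_add (J : H →L[ℝ] Lp ℝ 2 P) (θ φ : H) :
    ∀ᵐ ω ∂P, J (θ + φ) ω = J θ ω + J φ ω := by
  rw [map_add]
  exact Lp.coeFn_add _ _

lemma ae_smul (J : H →L[ℝ] Lp ℝ 2 P) (c : ℝ) (θ : H) :
    ∀ᵐ ω ∂P, J (c • θ) ω = c * J θ ω := by
  rw [map_smul]
  filter_upwards [Lp.coeFn_smul c (J θ)] with ω h
  simp [h]

/-- The class of `exp (-J θ)` in `L^r(P)`. -/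
noncomputable def expLp (hJ : IsSubgaussianMap J) {r : ℝ≥0∞} (hr : r ≠ ∞) (θ : H) : Lp ℝ r P :=
  (hJ.memLp_exp_neg hr θ).toLp

lemma coeFn_expLp (hJ : IsSubgaussianMap J) {r : ℝ≥0∞} (hr : r ≠ ∞) (θ : H) :
    hJ.expLp hr θ =ᵐ[P] fun ω => Real.exp (-J θ ω) :=
  MemLp.coeFn_toLp _

/-- The `r`-th moment of `exp (-J θ)` is the moment generating function of `J θ` at `-r`, at most
`exp (r² ‖θ‖² / 2)`; take the `r`-th root. -/
lemma norm_expLp_le (hJ : IsSubgaussianMap J) {r : ℝ≥0∞} [Fact (1 ≤ r)] (hr : r ≠ ∞) (θ : H) :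
    ‖hJ.expLp hr θ‖ ≤ Real.exp (r.toReal * ‖θ‖ ^ 2 / 2) := by
  have hr1 : 1 ≤ r := Fact.out
  have hr0 : 0 < r.toReal := ENNReal.toReal_pos (zero_lt_one.trans_le hr1).ne' hr
  have hr0' : r ≠ 0 := (zero_lt_one.trans_le hr1).ne'
  rw [Lp.norm_def, (Lp.memLp _).eLpNorm_eq_integral_rpow_norm hr0' hr,
    ENNReal.toReal_ofReal (by positivity)]
  have h1 : ∫ ω, ‖hJ.expLp hr θ ω‖ ^ r.toReal ∂P = mgf (J θ) P (-r.toReal) := by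
    refine integral_congr_ae ?_
    filter_upwards [hJ.coeFn_expLp hr θ] with ω h
    rw [h, Real.norm_of_nonneg (Real.exp_nonneg _), ← Real.exp_mul]
    ring_nf
  rw [h1]
  refine (Real.rpow_le_rpow mgf_nonneg ((hJ θ).mgf_le _) (by positivity)).trans_eq ?_
  rw [← Real.exp_mul]
  congr 1
  push_cast
  field_simp

/-- By homogeneity a unit vector `u` suffices, and there `|x| ≤ exp x + exp (-x)` reduces the claim
to `norm_expLp_le`. The bound is linear in `‖θ‖`, as continuity into `L^r` requires. -/
lemma norm_toLp_le (hJ : IsSubgaussianMap J) {r : ℝ≥0∞} [Fact (1 ≤ r)] (hr : r ≠ ∞) (θ : H) :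
    ‖(hJ.memLp hr θ).toLp‖ ≤ 2 * Real.exp (r.toReal / 2) * ‖θ‖ := by
  rcases eq_or_ne θ 0 with rfl | hθ
  · have : (hJ.memLp hr (0 : H)).toLp = 0 := by
      rw [Lp.ext_iff]
      refine (MemLp.coeFn_toLp _).trans ?_
      rw [map_zero]
      exact (Lp.coeFn_zero _ _ _).trans (Lp.coeFn_zero _ _ _).symm
    rw [this, norm_zero, norm_zero, mul_zero]
  have hn : 0 < ‖θ‖ := norm_pos_iff.2 hθ
  set u := ‖θ‖⁻¹ • θ with hu
  have hu1 : ‖u‖ = 1 := by rw [hu, norm_smul, norm_inv, norm_norm, inv_mul_cancel₀ hn.ne']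
  have key : ‖(hJ.memLp hr θ).toLp‖ ≤ ‖‖θ‖ • (hJ.expLp hr u + hJ.expLp hr (-u))‖ := by
    refine Lp.norm_le_norm_of_ae_le ?_
    filter_upwards [MemLp.coeFn_toLp (hJ.memLp hr θ), Lp.coeFn_smul ‖θ‖
      (hJ.expLp hr u + hJ.expLp hr (-u)), Lp.coeFn_add (hJ.expLp hr u) (hJ.expLp hr (-u)),
      hJ.coeFn_expLp hr u, hJ.coeFn_expLp hr (-u), ae_smul J ‖θ‖ u, ae_smul J (-1) u]
      with ω h1 h2 h3 h4 h5 h6 h7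
    rw [hu, smul_inv_smul₀ hn.ne', ← hu] at h6
    rw [neg_one_smul] at h7
    rw [h1, h2, Pi.smul_apply, h3, Pi.add_apply, h4, h5, h7, h6, smul_eq_mul, norm_mul, norm_mul]
    refine mul_le_mul_of_nonneg_left ?_ (norm_nonneg _)
    rw [Real.norm_eq_abs, Real.norm_of_nonneg (by positivity)]
    refine abs_le.2 ⟨?_, ?_⟩ <;>
    nlinarith [Real.add_one_le_exp (-J u ω), Real.add_one_le_exp (-(-1 * J u ω)),
      Real.exp_pos (-J u ω), Real.exp_pos (-(-1 * J u ω))]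
  refine key.trans ?_
  rw [norm_smul, norm_norm, mul_comm]
  refine mul_le_mul_of_nonneg_right ?_ (norm_nonneg _)
  refine (norm_add_le _ _).trans ?_
  have h1 := hJ.norm_expLp_le hr u
  have h2 := hJ.norm_expLp_le hr (-u)
  rw [norm_neg] at h2
  rw [hu1, one_pow, mul_one] at h1 h2
  linarith

/-- A subgaussian map, seen as a continuous linear map into `L^r(P)`. -/
noncomputable def toLpL (hJ : IsSubgaussianMap J) {r : ℝ≥0∞} [Fact (1 ≤ r)] (hr : r ≠ ∞) :
    H →L[ℝ] Lp ℝ r P :=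
  LinearMap.mkContinuous
    { toFun := fun θ => (hJ.memLp hr θ).toLp
      map_add' := fun θ φ => by
        rw [← MemLp.toLp_add]
        exact MemLp.toLp_congr _ _ (ae_add J θ φ)
      map_smul' := fun c θ => by
        rw [RingHom.id_apply, ← MemLp.toLp_const_smul]
        exact MemLp.toLp_congr _ _ (ae_smul J c θ) }
    (2 * Real.exp (r.toReal / 2)) (hJ.norm_toLp_le hr)

lemma coeFn_toLpL (hJ : IsSubgaussianMap J) {r : ℝ≥0∞} [Fact (1 ≤ r)] (hr : r ≠ ∞) (θ : H) :
    hJ.toLpL hr θ =ᵐ[P] J θ :=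
  (hJ.memLp hr θ).coeFn_toLp

end IsSubgaussianMap

/-! ### Differentiability of `exp (-J)` into `L^r`. -/

/-- The product `L^p × L^p → L^r`, when `1 / p + 1 / p = 1 / r`. -/
noncomputable abbrev lpMulL {Ω : Type*} {mΩ : MeasurableSpace Ω} (P : Measure Ω) (p r : ℝ≥0∞)
    [Fact (1 ≤ p)] [Fact (1 ≤ r)] [ENNReal.HolderTriple p p r] :
    Lp ℝ p P →L[ℝ] Lp ℝ p P →L[ℝ] Lp ℝ r P :=
  (ContinuousLinearMap.mul ℝ ℝ).holderL P p p r

lemma coeFn_lpMulL {Ω : Type*} {mΩ : MeasurableSpace Ω} {P : Measure Ω} {p r : ℝ≥0∞}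
    [Fact (1 ≤ p)] [Fact (1 ≤ r)] [ENNReal.HolderTriple p p r] (f g : Lp ℝ p P) :
    lpMulL P p r f g =ᵐ[P] fun ω => f ω * g ω :=
  (ContinuousLinearMap.mul ℝ ℝ).coeFn_holder f g

/-- Here `a`, `x`, `c` stand for `J θ ω`, `J u ω`, `‖φ‖`, where `φ = ‖φ‖ u`. The factor `c ^ 2`
comes out, and what remains is `exp (-J)` at `θ ± 2u`, whose `L^r` norm is bounded uniformly in `‖u‖
≤ 1`. The ingredients are Taylor's bound, `x² ≤ 2 exp |x|` and `exp (2|x|) ≤ exp (2x) + exp (-2x)`.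
-/
lemma abs_exp_neg_add_sub_le (a x : ℝ) {c : ℝ} (hc : |c| ≤ 1) :
    |Real.exp (-(a + c * x)) - Real.exp (-a) + Real.exp (-a) * (c * x)| ≤
      2 * c ^ 2 * (Real.exp (-(a + 2 * x)) + Real.exp (-(a - 2 * x))) := by
  have h1 : |Real.exp (-(c * x)) - 1 + c * x| ≤ (c * x) ^ 2 * Real.exp |c * x| := by
    have := Complex.norm_exp_sub_sum_le_norm_mul_exp ((-(c * x) : ℝ) : ℂ) 2
    rw [← Complex.ofReal_exp] at this
    simp only [Finset.sum_range_succ, Finset.range_zero, Finset.sum_empty] at this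
    norm_cast at this
    simp only [pow_zero, Nat.factorial, pow_one, Real.norm_eq_abs, abs_neg, sq_abs] at this
    norm_num at this
    rw [← abs_mul] at this
    convert! this using 2
    ring
  have h2 : (c * x) ^ 2 * Real.exp |c * x| ≤ c ^ 2 * (2 * Real.exp |x|) * Real.exp |x| := by
    have h3 : |c * x| ≤ |x| := by
      rw [abs_mul]
      exact mul_le_of_le_one_left (abs_nonneg _) hc
    have h4 : x ^ 2 ≤ 2 * Real.exp |x| := by
      have := Real.quadratic_le_exp_of_nonneg (abs_nonneg x)
      rw [← sq_abs]
      nlinarith [abs_nonneg x]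
    rw [mul_pow]
    gcongr
  have h5 : Real.exp |x| * Real.exp |x| ≤ Real.exp (-(2 * x)) + Real.exp (2 * x) := by
    rw [← Real.exp_add]
    rcases abs_cases x with ⟨h, -⟩ | ⟨h, -⟩ <;> rw [h]
    · have := Real.exp_pos (-(2 * x))
      rw [← two_mul]
      linarith
    · have := Real.exp_pos (2 * x)
      have h6 : -x + -x = -(2 * x) := by ring
      rw [h6]
      linarith
  have h7 : Real.exp (-(a + c * x)) - Real.exp (-a) + Real.exp (-a) * (c * x) =
      Real.exp (-a) * (Real.exp (-(c * x)) - 1 + c * x) := by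
    rw [neg_add, Real.exp_add]
    ring
  rw [h7, abs_mul, Real.abs_exp]
  have h8 : Real.exp (-(a + 2 * x)) + Real.exp (-(a - 2 * x)) =
      Real.exp (-a) * (Real.exp (-(2 * x)) + Real.exp (2 * x)) := by
    rw [mul_add, ← Real.exp_add, ← Real.exp_add]
    ring_nf
  rw [h8]
  calc _ ≤ Real.exp (-a) * (c ^ 2 * (2 * Real.exp |x|) * Real.exp |x|) := by gcongr; exact h1.trans h2
    _ = 2 * c ^ 2 * (Real.exp (-a) * (Real.exp |x| * Real.exp |x|)) := by ring
    _ ≤ _ := by gcongr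

namespace IsSubgaussianMap

variable {Ω : Type*} {mΩ : MeasurableSpace Ω} {P : Measure Ω} {H : Type*}
  [NormedAddCommGroup H] [InnerProductSpace ℝ H] {J : H →L[ℝ] Lp ℝ 2 P}

lemma norm_expLp_add_sub_le (hJ : IsSubgaussianMap J) {p r : ℝ≥0∞} [Fact (1 ≤ p)] [Fact (1 ≤ r)]
    [ENNReal.HolderTriple p p r] (hp : p ≠ ∞) (hr : r ≠ ∞) (θ φ : H) (hφ : ‖φ‖ ≤ 1) :
    ‖hJ.expLp hr (θ + φ) - hJ.expLp hr θ + lpMulL P p r (hJ.expLp hp θ) (hJ.toLpL hp φ)‖ ≤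
      4 * Real.exp (r.toReal * (‖θ‖ + 2) ^ 2 / 2) * ‖φ‖ ^ 2 := by
  -- Only `‖u‖ ≤ 1` is asked, so that `u = 0` serves when `φ = 0`.
  obtain ⟨u, hu1, hu⟩ : ∃ u : H, ‖u‖ ≤ 1 ∧ φ = ‖φ‖ • u := by
    rcases eq_or_ne φ 0 with rfl | h
    · exact ⟨0, by simp, by simp⟩
    · have hn : ‖φ‖ ≠ 0 := norm_ne_zero_iff.2 h
      refine ⟨‖φ‖⁻¹ • φ, ?_, (smul_inv_smul₀ hn φ).symm⟩
      rw [norm_smul, norm_inv, norm_norm, inv_mul_cancel₀ hn]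
  have key : ‖hJ.expLp hr (θ + φ) - hJ.expLp hr θ +
        lpMulL P p r (hJ.expLp hp θ) (hJ.toLpL hp φ)‖ ≤
      ‖(2 * ‖φ‖ ^ 2) • (hJ.expLp hr (θ + (2 : ℝ) • u) + hJ.expLp hr (θ + (-2 : ℝ) • u))‖ := by
    refine Lp.norm_le_norm_of_ae_le ?_
    have hφu := ae_smul J ‖φ‖ u
    rw [← hu] at hφu
    filter_upwards [Lp.coeFn_add (hJ.expLp hr (θ + φ) - hJ.expLp hr θ)
        (lpMulL P p r (hJ.expLp hp θ) (hJ.toLpL hp φ)),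
      Lp.coeFn_sub (hJ.expLp hr (θ + φ)) (hJ.expLp hr θ),
      coeFn_lpMulL (r := r) (hJ.expLp hp θ) (hJ.toLpL hp φ),
      hJ.coeFn_expLp hr (θ + φ), hJ.coeFn_expLp hr θ, hJ.coeFn_expLp hp θ, hJ.coeFn_toLpL hp φ,
      Lp.coeFn_smul (2 * ‖φ‖ ^ 2)
        (hJ.expLp hr (θ + (2 : ℝ) • u) + hJ.expLp hr (θ + (-2 : ℝ) • u)),
      Lp.coeFn_add (hJ.expLp hr (θ + (2 : ℝ) • u)) (hJ.expLp hr (θ + (-2 : ℝ) • u)),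
      hJ.coeFn_expLp hr (θ + (2 : ℝ) • u), hJ.coeFn_expLp hr (θ + (-2 : ℝ) • u),
      ae_add J θ φ, ae_add J θ ((2 : ℝ) • u), ae_add J θ ((-2 : ℝ) • u), hφu,
      ae_smul J 2 u, ae_smul J (-2) u]
      with ω h1 h2 h3 h4 h5 h6 h7 h8 h9 h10 h11 h12 h13 h14 h15 h16 h17
    rw [h1, Pi.add_apply, h2, Pi.sub_apply, h3, h4, h5, h6, h7, h8, Pi.smul_apply, h9,
      Pi.add_apply, h10, h11, h12, h13, h14, h15, h16, h17, Real.norm_eq_abs, smul_eq_mul,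
      Real.norm_of_nonneg (by positivity), neg_mul, ← sub_eq_add_neg (J θ ω)]
    exact abs_exp_neg_add_sub_le _ _ (by rwa [abs_norm])
  refine key.trans ?_
  have hb : ∀ c : ℝ, |c| = 2 →
      ‖hJ.expLp hr (θ + c • u)‖ ≤ Real.exp (r.toReal * (‖θ‖ + 2) ^ 2 / 2) := by
    intro c hc
    refine (hJ.norm_expLp_le hr _).trans ?_
    have : ‖θ + c • u‖ ≤ ‖θ‖ + 2 := by
      refine (norm_add_le _ _).trans ?_
      rw [norm_smul, Real.norm_eq_abs, hc]
      linarith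
    gcongr
  rw [norm_smul, Real.norm_of_nonneg (by positivity)]
  have := (norm_add_le (hJ.expLp hr (θ + (2 : ℝ) • u)) (hJ.expLp hr (θ + (-2 : ℝ) • u))).trans
    (add_le_add (hb 2 (by norm_num)) (hb (-2) (by norm_num)))
  calc _ ≤ 2 * ‖φ‖ ^ 2 * _ := mul_le_mul_of_nonneg_left this (by positivity)
    _ = _ := by ring

lemma hasFDerivAt_expLp (hJ : IsSubgaussianMap J) {p r : ℝ≥0∞} [Fact (1 ≤ p)] [Fact (1 ≤ r)]
    [ENNReal.HolderTriple p p r] (hp : p ≠ ∞) (hr : r ≠ ∞) (θ : H) :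
    HasFDerivAt (hJ.expLp hr) (-(lpMulL P p r (hJ.expLp hp θ) ∘L hJ.toLpL hp)) θ := by
  rw [hasFDerivAt_iff_isLittleO_nhds_zero]
  refine Asymptotics.IsBigO.trans_isLittleO (g := fun φ : H => ‖φ‖ ^ 2) ?_
    (Asymptotics.isLittleO_norm_pow_id one_lt_two)
  refine Asymptotics.IsBigO.of_bound (4 * Real.exp (r.toReal * (‖θ‖ + 2) ^ 2 / 2)) ?_
  filter_upwards [Metric.closedBall_mem_nhds (0 : H) one_pos] with φ hφ
  rw [mem_closedBall_zero_iff] at hφ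
  have := hJ.norm_expLp_add_sub_le hp hr θ φ hφ
  rw [Real.norm_of_nonneg (by positivity : 0 ≤ ‖φ‖ ^ 2)]
  simpa [sub_neg_eq_add] using this

/-! ### The maps `Φ` and `exp Φ` into `L^r`, with two differentials each. -/

/-- The map `θ ↦ exp (-J θ + ‖θ‖² / 2)` with values in `L^r(P)`. -/
noncomputable def expPhiLp (hJ : IsSubgaussianMap J) {r : ℝ≥0∞} (hr : r ≠ ∞) (θ : H) : Lp ℝ r P :=
  Real.exp (1 / 2 * ‖θ‖ ^ 2) • hJ.expLp hr θ

lemma coeFn_expPhiLp (hJ : IsSubgaussianMap J) {r : ℝ≥0∞} (hr : r ≠ ∞) (θ : H) :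
    hJ.expPhiLp hr θ =ᵐ[P] fun ω => Real.exp (-J θ ω + 1 / 2 * ‖θ‖ ^ 2) := by
  filter_upwards [Lp.coeFn_smul (Real.exp (1 / 2 * ‖θ‖ ^ 2)) (hJ.expLp hr θ),
    hJ.coeFn_expLp hr θ] with ω h1 h2
  rw [expPhiLp, h1, Pi.smul_apply, h2, Real.exp_add, smul_eq_mul, mul_comm]

section Finite

variable [IsFiniteMeasure P]

variable (P H) in
/-- The bilinear map `(θ, ψ) ↦ ⟨θ, ψ⟩ 1` with values in `L^r(P)`. -/
noncomputable def innerOneL (r : ℝ≥0∞) [Fact (1 ≤ r)] : H →L[ℝ] H →L[ℝ] Lp ℝ r P :=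
  (ContinuousLinearMap.smulRightL ℝ H (Lp ℝ r P)).flip (Lp.const r P 1) ∘L innerSL ℝ

lemma innerOneL_apply {r : ℝ≥0∞} [Fact (1 ≤ r)] (θ ψ : H) :
    innerOneL P H r θ ψ = inner ℝ θ ψ • Lp.const r P 1 := rfl

lemma coeFn_innerOneL {r : ℝ≥0∞} [Fact (1 ≤ r)] (θ ψ : H) :
    innerOneL P H r θ ψ =ᵐ[P] fun _ => inner ℝ θ ψ := by
  rw [innerOneL_apply]
  filter_upwards [Lp.coeFn_smul (inner ℝ θ ψ) (Lp.const r P (1 : ℝ)), Lp.coeFn_const r P (1 : ℝ)]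
    with ω h1 h2
  rw [h1, Pi.smul_apply, h2, Function.const_apply, smul_eq_mul, mul_one]

/-- The map `θ ↦ -J θ + ‖θ‖² / 2` with values in `L^r(P)`. -/
noncomputable def phiLp (hJ : IsSubgaussianMap J) {r : ℝ≥0∞} [Fact (1 ≤ r)] (hr : r ≠ ∞)
    (θ : H) : Lp ℝ r P :=
  -hJ.toLpL hr θ + (1 / 2 * ‖θ‖ ^ 2) • Lp.const r P 1

/-- The differential of `phiLp`. -/
noncomputable def dphiLp (hJ : IsSubgaussianMap J) {r : ℝ≥0∞} [Fact (1 ≤ r)] (hr : r ≠ ∞)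
    (θ : H) : H →L[ℝ] Lp ℝ r P :=
  -hJ.toLpL hr + innerOneL P H r θ

lemma coeFn_phiLp (hJ : IsSubgaussianMap J) {r : ℝ≥0∞} [Fact (1 ≤ r)] (hr : r ≠ ∞) (θ : H) :
    hJ.phiLp hr θ =ᵐ[P] fun ω => -J θ ω + 1 / 2 * ‖θ‖ ^ 2 := by
  filter_upwards [Lp.coeFn_add (-hJ.toLpL hr θ) ((1 / 2 * ‖θ‖ ^ 2) • Lp.const r P (1 : ℝ)),
    Lp.coeFn_neg (hJ.toLpL hr θ), hJ.coeFn_toLpL hr θ,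
    Lp.coeFn_smul (1 / 2 * ‖θ‖ ^ 2) (Lp.const r P (1 : ℝ)), Lp.coeFn_const r P (1 : ℝ)]
    with ω h1 h2 h3 h4 h5
  rw [phiLp, h1, Pi.add_apply, h2, Pi.neg_apply, h3, h4, Pi.smul_apply, h5, Function.const_apply,
    smul_eq_mul, mul_one]

lemma coeFn_dphiLp (hJ : IsSubgaussianMap J) {r : ℝ≥0∞} [Fact (1 ≤ r)] (hr : r ≠ ∞) (θ ψ : H) :
    hJ.dphiLp hr θ ψ =ᵐ[P] fun ω => -J ψ ω + inner ℝ θ ψ := by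
  filter_upwards [Lp.coeFn_add (-hJ.toLpL hr ψ) (innerOneL P H r θ ψ),
    Lp.coeFn_neg (hJ.toLpL hr ψ), hJ.coeFn_toLpL hr ψ, coeFn_innerOneL (P := P) (r := r) θ ψ]
    with ω h1 h2 h3 h4
  rw [dphiLp, add_apply, neg_apply, h1, Pi.add_apply, h2,
    Pi.neg_apply, h3, h4]

lemma hasFDerivAt_half_norm_sq (θ : H) :
    HasFDerivAt (fun θ : H => 1 / 2 * ‖θ‖ ^ 2) (innerSL ℝ θ) θ := by
  refine (((hasFDerivAt_id θ).norm_sq).const_mul (1 / 2)).congr_fderiv ?_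
  ext ψ
  simp

lemma hasFDerivAt_phiLp (hJ : IsSubgaussianMap J) {r : ℝ≥0∞} [Fact (1 ≤ r)] (hr : r ≠ ∞)
    (θ : H) : HasFDerivAt (hJ.phiLp hr) (hJ.dphiLp hr θ) θ :=
  (hJ.toLpL hr).hasFDerivAt.neg.add ((hasFDerivAt_half_norm_sq θ).smul_const _)

/-- The differential of `Φ` is affine in `θ`, so the second one is constant. -/
lemma hasFDerivAt_dphiLp (hJ : IsSubgaussianMap J) {r : ℝ≥0∞} [Fact (1 ≤ r)] (hr : r ≠ ∞)
    (θ : H) : HasFDerivAt (hJ.dphiLp hr) (innerOneL P H r) θ :=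
  (innerOneL P H r).hasFDerivAt.const_add _

variable {p r : ℝ≥0∞} [Fact (1 ≤ p)] [Fact (1 ≤ r)] [ENNReal.HolderTriple p p r]

/-- Identifies the classes of one random variable at the exponents `p` and `r`, so that both terms
of the product rule for `exp Φ` can be written with the same factor. -/
lemma lpMulL_expLp_const (hJ : IsSubgaussianMap J) (hp : p ≠ ∞) (hr : r ≠ ∞) (θ : H) :
    lpMulL P p r (hJ.expLp hp θ) (Lp.const p P 1) = hJ.expLp hr θ := by
  rw [Lp.ext_iff]
  filter_upwards [coeFn_lpMulL (r := r) (hJ.expLp hp θ) (Lp.const p P 1), hJ.coeFn_expLp hp θ,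
    hJ.coeFn_expLp hr θ, Lp.coeFn_const p P (1 : ℝ)] with ω h1 h2 h3 h4
  rw [h1, h2, h3, h4, Function.const_apply, mul_one]

/-- The product rule for `exp (‖θ‖² / 2) • exp (-J θ)`: its two terms recombine into `exp Φ · DΦ`, a
product of two elements of `L^p`. -/
lemma hasFDerivAt_expPhiLp (hJ : IsSubgaussianMap J) (hp : p ≠ ∞) (hr : r ≠ ∞) (θ : H) :
    HasFDerivAt (hJ.expPhiLp hr) (lpMulL P p r (hJ.expPhiLp hp θ) ∘L hJ.dphiLp hp θ) θ := by
  refine ((hasFDerivAt_half_norm_sq θ).exp.smul (hJ.hasFDerivAt_expLp hp hr θ)).congr_fderiv ?_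
  refine ContinuousLinearMap.ext fun ψ => ?_
  have h := hJ.lpMulL_expLp_const hp hr θ
  simp only [expPhiLp, dphiLp, add_apply, smul_apply, neg_apply, ContinuousLinearMap.comp_apply,
    ContinuousLinearMap.smulRight_apply, map_add, map_neg, map_smul, innerOneL_apply, h,
    innerSL_apply_apply, smul_eq_mul, mul_smul]
  rw [smul_neg, smul_comm (inner ℝ θ ψ)]

/-- The second differential of `expPhiLp`. -/
noncomputable def d2expPhiLp (hJ : IsSubgaussianMap J) {q : ℝ≥0∞} [Fact (1 ≤ q)]
    [ENNReal.HolderTriple q q p] (hq : q ≠ ∞) (hp : p ≠ ∞) (r : ℝ≥0∞) [Fact (1 ≤ r)]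
    [ENNReal.HolderTriple p p r] (θ : H) : H →L[ℝ] H →L[ℝ] Lp ℝ r P :=
  ContinuousLinearMap.compL ℝ H (Lp ℝ p P) (Lp ℝ r P) (lpMulL P p r (hJ.expPhiLp hp θ)) ∘L
      innerOneL P H p +
    (ContinuousLinearMap.compL ℝ H (Lp ℝ p P) (Lp ℝ r P)).flip (hJ.dphiLp hp θ) ∘L
      (lpMulL P p r ∘L (lpMulL P q p (hJ.expPhiLp hq θ) ∘L hJ.dphiLp hq θ))

/-- The factor `exp Φ`, now in `L^p`, is differentiated through `L^q`; the product rule adds the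
term in which the affine factor `DΦ` is differentiated. -/
lemma hasFDerivAt_dexpPhiLp (hJ : IsSubgaussianMap J) {q : ℝ≥0∞} [Fact (1 ≤ q)]
    [ENNReal.HolderTriple q q p] (hq : q ≠ ∞) (hp : p ≠ ∞) (θ : H) :
    HasFDerivAt (fun θ => lpMulL P p r (hJ.expPhiLp hp θ) ∘L hJ.dphiLp hp θ)
      (hJ.d2expPhiLp hq hp r θ) θ :=
  ((lpMulL P p r).hasFDerivAt.comp θ (hJ.hasFDerivAt_expPhiLp hq hp θ)).clm_comp
    (hJ.hasFDerivAt_dphiLp hp θ)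

lemma coeFn_dexpPhiLp (hJ : IsSubgaussianMap J) (hp : p ≠ ∞) (θ ψ : H) :
    (lpMulL P p r (hJ.expPhiLp hp θ) ∘L hJ.dphiLp hp θ) ψ =ᵐ[P] fun ω =>
      Real.exp (-J θ ω + 1 / 2 * ‖θ‖ ^ 2) * (-J ψ ω + inner ℝ θ ψ) := by
  filter_upwards [coeFn_lpMulL (r := r) (hJ.expPhiLp hp θ) (hJ.dphiLp hp θ ψ),
    hJ.coeFn_expPhiLp hp θ, hJ.coeFn_dphiLp hp θ ψ] with ω h1 h2 h3
  rw [ContinuousLinearMap.comp_apply, h1, h2, h3]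

lemma coeFn_d2expPhiLp (hJ : IsSubgaussianMap J) {q : ℝ≥0∞} [Fact (1 ≤ q)]
    [ENNReal.HolderTriple q q p] (hq : q ≠ ∞) (hp : p ≠ ∞) (θ ψ φ : H) :
    hJ.d2expPhiLp hq hp r θ ψ φ =ᵐ[P] fun ω =>
      Real.exp (-J θ ω + 1 / 2 * ‖θ‖ ^ 2) *
        ((-J ψ ω + inner ℝ θ ψ) * (-J φ ω + inner ℝ θ φ) + inner ℝ φ ψ) := by
  have h0 : hJ.d2expPhiLp hq hp r θ ψ φ =
      lpMulL P p r (hJ.expPhiLp hp θ) (innerOneL P H p ψ φ) +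
      lpMulL P p r ((lpMulL P q p (hJ.expPhiLp hq θ) ∘L hJ.dphiLp hq θ) ψ) (hJ.dphiLp hp θ φ) := rfl
  rw [h0]
  filter_upwards [Lp.coeFn_add (lpMulL P p r (hJ.expPhiLp hp θ) (innerOneL P H p ψ φ))
      (lpMulL P p r ((lpMulL P q p (hJ.expPhiLp hq θ) ∘L hJ.dphiLp hq θ) ψ) (hJ.dphiLp hp θ φ)),
    coeFn_lpMulL (r := r) (hJ.expPhiLp hp θ) (innerOneL P H p ψ φ),
    coeFn_lpMulL (r := r) ((lpMulL P q p (hJ.expPhiLp hq θ) ∘L hJ.dphiLp hq θ) ψ)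
      (hJ.dphiLp hp θ φ),
    hJ.coeFn_dexpPhiLp (r := p) hq θ ψ, hJ.coeFn_dphiLp hp θ φ, hJ.coeFn_expPhiLp hp θ,
    coeFn_innerOneL (P := P) (r := p) ψ φ] with ω h1 h2 h3 h4 h5 h6 h7
  rw [h1, Pi.add_apply, h2, h3, h4, h5, h6, h7, real_inner_comm φ ψ]
  ring

end Finite

end IsSubgaussianMap

/-! ### Differentials of the weighted expectation. -/

namespace IsSubgaussianMap

variable {Ω : Type*} {mΩ : MeasurableSpace Ω} {P : Measure Ω} [IsFiniteMeasure P] {H : Type*}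
  [NormedAddCommGroup H] [InnerProductSpace ℝ H] {J : H →L[ℝ] Lp ℝ 2 P}

/-- The functional `θ ↦ E[Z exp (-J θ + ‖θ‖² / 2)]`. -/
noncomputable def expectation (J : H →L[ℝ] Lp ℝ 2 P) (Z : Ω → ℝ) (θ : H) : ℝ :=
  ∫ ω, Z ω * Real.exp (-J θ ω + 1 / 2 * ‖θ‖ ^ 2) ∂P

section Differentiability

variable {s r p q : ℝ≥0∞} [Fact (1 ≤ s)] [Fact (1 ≤ r)] [Fact (1 ≤ p)] [Fact (1 ≤ q)]
  [s.HolderConjugate r] [ENNReal.HolderTriple p p r] [ENNReal.HolderTriple q q p] {Z : Ω → ℝ}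

/-- The functional `Y ↦ E[Z Y]` on `L^r(P)`, for `Z ∈ L^s(P)`. -/
noncomputable def weightL (r : ℝ≥0∞) [Fact (1 ≤ r)] [s.HolderConjugate r] (hZ : MemLp Z s P) :
    Lp ℝ r P →L[ℝ] ℝ :=
  (ContinuousLinearMap.mul ℝ ℝ).lpPairing P s r hZ.toLp

omit [IsFiniteMeasure P] in
lemma weightL_apply (hZ : MemLp Z s P) {Y : Lp ℝ r P} {Y' : Ω → ℝ} (h : Y =ᵐ[P] Y') :
    weightL r hZ Y = ∫ ω, Z ω * Y' ω ∂P := by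
  rw [weightL, ContinuousLinearMap.lpPairing_eq_integral]
  refine integral_congr_ae ?_
  filter_upwards [hZ.coeFn_toLp, h] with ω h1 h2
  rw [h1, h2, ContinuousLinearMap.mul_apply']

omit [IsFiniteMeasure P] [Fact (1 ≤ s)] [Fact (1 ≤ r)] in
lemma integrable_weight_mul (hZ : MemLp Z s P) {Y : Lp ℝ r P} {Y' : Ω → ℝ} (h : Y =ᵐ[P] Y') :
    Integrable (fun ω => Z ω * Y' ω) P :=
  hZ.integrable_mul ((memLp_congr_ae h).1 (Lp.memLp Y))

omit [IsFiniteMeasure P] in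
lemma expectation_eq_weightL (hJ : IsSubgaussianMap J) (hr : r ≠ ∞) (hZ : MemLp Z s P) :
    expectation J Z = fun θ => weightL r hZ (hJ.expPhiLp hr θ) :=
  funext fun θ => (weightL_apply hZ (hJ.coeFn_expPhiLp hr θ)).symm

lemma hasFDerivAt_expectation (hJ : IsSubgaussianMap J) (hp : p ≠ ∞) (hr : r ≠ ∞)
    (hZ : MemLp Z s P) (θ : H) :
    HasFDerivAt (expectation J Z)
      (weightL r hZ ∘L (lpMulL P p r (hJ.expPhiLp hp θ) ∘L hJ.dphiLp hp θ)) θ := by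
  rw [expectation_eq_weightL hJ hr hZ]
  exact (weightL r hZ).hasFDerivAt.comp θ (hJ.hasFDerivAt_expPhiLp hp hr θ)

lemma hasFDerivAt_fderiv_expectation (hJ : IsSubgaussianMap J) (hq : q ≠ ∞) (hp : p ≠ ∞)
    (hr : r ≠ ∞) (hZ : MemLp Z s P) (θ : H) :
    HasFDerivAt (fderiv ℝ (expectation J Z))
      (ContinuousLinearMap.compL ℝ H (Lp ℝ r P) ℝ (weightL r hZ) ∘L hJ.d2expPhiLp hq hp r θ) θ := by
  rw [show fderiv ℝ (expectation J Z) = fun θ => ContinuousLinearMap.compL ℝ H (Lp ℝ r P) ℝ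
      (weightL r hZ) (lpMulL P p r (hJ.expPhiLp hp θ) ∘L hJ.dphiLp hp θ) from
    funext fun θ => (hasFDerivAt_expectation hJ hp hr hZ θ).fderiv]
  exact (ContinuousLinearMap.hasFDerivAt _).comp θ (hJ.hasFDerivAt_dexpPhiLp hq hp θ)

end Differentiability

/-- Exponents with which the second differential of the expectation is computed. -/
lemma exists_exponents {s : ℝ≥0∞} (hs : 1 < s) :
    ∃ r : ℝ≥0∞, r ≠ ∞ ∧ 1 ≤ r ∧ 1 ≤ 2 * r ∧ 1 ≤ 4 * r ∧ s.HolderConjugate r ∧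
      ENNReal.HolderTriple (2 * r) (2 * r) r ∧ ENNReal.HolderTriple (4 * r) (4 * r) (2 * r) := by
  have := ENNReal.HolderConjugate.conjExponent hs.le
  have hr1 : 1 ≤ s.conjExponent := ENNReal.HolderConjugate.one_le _ s
  have h2 : ∀ x : ℝ≥0∞, ENNReal.HolderTriple (2 * x) (2 * x) x := fun x => ⟨by
    rw [ENNReal.mul_inv (by simp) (by simp), ← add_mul, ENNReal.inv_two_add_inv_two, one_mul]⟩
  refine ⟨s.conjExponent, ?_, hr1, hr1.trans (le_mul_of_one_le_left zero_le one_le_two),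
    hr1.trans (le_mul_of_one_le_left zero_le (by norm_num)), this, h2 _, ?_⟩
  -- Integrability of the weight beyond order one enters here: it makes the conjugate exponent
  -- finite, and the moment bounds need finite exponents.
  · exact (ENNReal.HolderConjugate.ne_top_iff_ne_one (p := s.conjExponent) (q := s)).2 hs.ne'
  · have := h2 (2 * s.conjExponent)
    rwa [← mul_assoc, show (2 : ℝ≥0∞) * 2 = 4 by norm_num] at this

variable {s : ℝ≥0∞} {Z : Ω → ℝ}

omit [IsFiniteMeasure P] in
lemma integrable_expectation (hJ : IsSubgaussianMap J) (hs : 1 < s) (hZ : MemLp Z s P) (θ : H) :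
    Integrable (fun ω => Z ω * Real.exp (-J θ ω + 1 / 2 * ‖θ‖ ^ 2)) P := by
  obtain ⟨r, hr, h1, -, -, _, -, -⟩ := exists_exponents hs
  exact integrable_weight_mul hZ (hJ.coeFn_expPhiLp hr θ)

lemma differentiableAt_expectation (hJ : IsSubgaussianMap J) (hs : 1 < s) (hZ : MemLp Z s P)
    (θ : H) : DifferentiableAt ℝ (expectation J Z) θ ∧
      DifferentiableAt ℝ (fderiv ℝ (expectation J Z)) θ := by
  obtain ⟨r, hr, h1, h2, h4, _, _, _⟩ := exists_exponents hs
  have hr2 : 2 * r ≠ ∞ := ENNReal.mul_ne_top (by simp) hr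
  have hr4 : 4 * r ≠ ∞ := ENNReal.mul_ne_top (by simp) hr
  have := Fact.mk hs.le
  have := Fact.mk h1
  have := Fact.mk h2
  have := Fact.mk h4
  exact ⟨(hasFDerivAt_expectation hJ hr2 hr hZ θ).differentiableAt,
    (hasFDerivAt_fderiv_expectation hJ hr4 hr2 hr hZ θ).differentiableAt⟩

lemma fderiv_expectation (hJ : IsSubgaussianMap J) (hs : 1 < s) (hZ : MemLp Z s P) (θ ψ : H) :
    Integrable (fun ω => Z ω * (Real.exp (-J θ ω + 1 / 2 * ‖θ‖ ^ 2) *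
      (-J ψ ω + inner ℝ θ ψ))) P ∧
    fderiv ℝ (expectation J Z) θ ψ =
      ∫ ω, Z ω * (Real.exp (-J θ ω + 1 / 2 * ‖θ‖ ^ 2) * (-J ψ ω + inner ℝ θ ψ)) ∂P := by
  obtain ⟨r, hr, h1, h2, -, _, _, -⟩ := exists_exponents hs
  have hr2 : 2 * r ≠ ∞ := ENNReal.mul_ne_top (by simp) hr
  have := Fact.mk hs.le
  have := Fact.mk h1
  have := Fact.mk h2
  have h := hJ.coeFn_dexpPhiLp (r := r) hr2 θ ψ
  refine ⟨integrable_weight_mul hZ h, ?_⟩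
  rw [(hasFDerivAt_expectation hJ hr2 hr hZ θ).fderiv]
  exact weightL_apply hZ h

lemma fderiv_fderiv_expectation (hJ : IsSubgaussianMap J) (hs : 1 < s) (hZ : MemLp Z s P)
    (θ ψ φ : H) :
    Integrable (fun ω => Z ω * (Real.exp (-J θ ω + 1 / 2 * ‖θ‖ ^ 2) *
      ((-J ψ ω + inner ℝ θ ψ) * (-J φ ω + inner ℝ θ φ) + inner ℝ φ ψ))) P ∧
    fderiv ℝ (fderiv ℝ (expectation J Z)) θ ψ φ =
      ∫ ω, Z ω * (Real.exp (-J θ ω + 1 / 2 * ‖θ‖ ^ 2) *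
        ((-J ψ ω + inner ℝ θ ψ) * (-J φ ω + inner ℝ θ φ) + inner ℝ φ ψ)) ∂P := by
  obtain ⟨r, hr, h1, h2, h4, _, _, _⟩ := exists_exponents hs
  have hr2 : 2 * r ≠ ∞ := ENNReal.mul_ne_top (by simp) hr
  have hr4 : 4 * r ≠ ∞ := ENNReal.mul_ne_top (by simp) hr
  have := Fact.mk hs.le
  have := Fact.mk h1
  have := Fact.mk h2
  have := Fact.mk h4
  have h := hJ.coeFn_d2expPhiLp (r := r) hr4 hr2 θ ψ φ
  refine ⟨integrable_weight_mul hZ h, ?_⟩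
  rw [(hasFDerivAt_fderiv_expectation hJ hr4 hr2 hr hZ θ).fderiv]
  exact weightL_apply hZ h

/-! ### Strict convexity and coercivity. -/

omit [IsFiniteMeasure P] in
/-- The function `θ ↦ -J θ + ‖θ‖² / 2` is strictly convex, almost surely at each pair of points. -/
lemma ae_exp_phi_lt (J : H →L[ℝ] Lp ℝ 2 P) {θ φ : H} (hne : θ ≠ φ) {a b : ℝ} (ha : 0 < a)
    (hb : 0 < b) (hab : a + b = 1) :
    ∀ᵐ ω ∂P, Real.exp (-J (a • θ + b • φ) ω + 1 / 2 * ‖a • θ + b • φ‖ ^ 2) <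
      a * Real.exp (-J θ ω + 1 / 2 * ‖θ‖ ^ 2) + b * Real.exp (-J φ ω + 1 / 2 * ‖φ‖ ^ 2) := by
  -- The defect `a b ‖θ - φ‖²` is deterministic and positive, while `J` contributes only a linear
  -- part to the exponent.
  have hn : ‖a • θ + b • φ‖ ^ 2 = a * ‖θ‖ ^ 2 + b * ‖φ‖ ^ 2 - a * b * ‖θ - φ‖ ^ 2 := by
    have hb' : b = 1 - a := by linarith
    rw [norm_add_sq_real, norm_sub_sq_real, norm_smul, norm_smul, real_inner_smul_left,
      real_inner_smul_right, Real.norm_of_nonneg ha.le, Real.norm_of_nonneg hb.le, hb']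
    ring
  have hpos : 0 < a * b * ‖θ - φ‖ ^ 2 := by
    have : 0 < ‖θ - φ‖ := norm_pos_iff.2 (sub_ne_zero.2 hne)
    positivity
  filter_upwards [ae_add J (a • θ) (b • φ), ae_smul J a θ, ae_smul J b φ] with ω h1 h2 h3
  rw [h1, h2, h3, hn]
  refine lt_of_lt_of_le (Real.exp_lt_exp.2 ?_) (convexOn_exp.2 (Set.mem_univ (-J θ ω +
    1 / 2 * ‖θ‖ ^ 2)) (Set.mem_univ (-J φ ω + 1 / 2 * ‖φ‖ ^ 2)) ha.le hb.le hab)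
  simp only [smul_eq_mul]
  linarith

omit [IsFiniteMeasure P] in
lemma strictConvexOn_expectation (hJ : IsSubgaussianMap J) (hs : 1 < s) (hZ : MemLp Z s P)
    (hZ0 : ∀ ω, 0 ≤ Z ω) (hpos : 0 < P {ω | 0 < Z ω}) :
    StrictConvexOn ℝ Set.univ (expectation J Z) := by
  refine ⟨convex_univ, fun θ _ φ _ hne a b ha hb hab => ?_⟩
  have iθ := (hJ.integrable_expectation hs hZ θ).const_mul a
  have iφ := (hJ.integrable_expectation hs hZ φ).const_mul b
  have i := hJ.integrable_expectation hs hZ (a • θ + b • φ)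
  have hlt := ae_exp_phi_lt J hne ha hb hab
  rw [expectation, expectation, expectation, smul_eq_mul, smul_eq_mul, ← integral_const_mul,
    ← integral_const_mul, ← integral_add iθ iφ]
  have hle : (fun ω => Z ω * Real.exp (-J (a • θ + b • φ) ω + 1 / 2 * ‖a • θ + b • φ‖ ^ 2)) ≤ᵐ[P]
      (fun ω => a * (Z ω * Real.exp (-J θ ω + 1 / 2 * ‖θ‖ ^ 2))) +
        fun ω => b * (Z ω * Real.exp (-J φ ω + 1 / 2 * ‖φ‖ ^ 2)) := by
    filter_upwards [hlt] with ω h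
    simp only [Pi.add_apply]
    nlinarith [mul_le_mul_of_nonneg_left h.le (hZ0 ω)]
  -- Equal integrals of ordered integrands would make these equal almost everywhere, which is
  -- impossible where `Z > 0`.
  refine (integral_mono_ae i (iθ.add iφ) hle).lt_of_ne fun heq => ?_
  rw [integral_eq_iff_of_ae_le i (iθ.add iφ) hle] at heq
  refine hpos.ne' (measure_eq_zero_iff_ae_notMem.2 ?_)
  filter_upwards [heq, hlt] with ω h1 h2 h3
  simp only [Pi.add_apply] at h1
  have h3 : 0 < Z ω := h3
  nlinarith [mul_lt_mul_of_pos_left h2 h3]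

/-- Bound the exponential below by a tangent line, `exp x ≥ exp m (1 + x - m)` at `x = -J θ ω`.
After integration against `Z`, randomness survives only through `L θ = E[Z J θ]`, a bounded
functional because `J` is continuous into `L^r`. -/
lemma exists_le_expectation (hJ : IsSubgaussianMap J) (hs : 1 < s) (hZ : MemLp Z s P)
    (hZ0 : ∀ ω, 0 ≤ Z ω) (hpos : 0 < P {ω | 0 < Z ω}) :
    ∃ z : ℝ, 0 < z ∧ ∃ C : ℝ, ∀ θ, z * Real.exp (1 / 2 * ‖θ‖ ^ 2 - C * ‖θ‖) ≤
      expectation J Z θ := by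
  obtain ⟨r, hr, h1, -, -, _, -, -⟩ := exists_exponents hs
  have := Fact.mk hs.le
  have := Fact.mk h1
  have hZi : Integrable Z P := hZ.integrable hs.le
  set z := ∫ ω, Z ω ∂P
  have hz : 0 < z := by
    refine (integral_pos_iff_support_of_nonneg hZ0 hZi).2 ?_
    refine hpos.trans_le (measure_mono fun ω (hω : 0 < Z ω) => hω.ne')
  set L : H →L[ℝ] ℝ := weightL r hZ ∘L hJ.toLpL hr
  have hL : ∀ θ, L θ = ∫ ω, Z ω * J θ ω ∂P := fun θ => weightL_apply hZ (hJ.coeFn_toLpL hr θ)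
  refine ⟨z, hz, ‖L‖ / z, fun θ => ?_⟩
  -- The tangent point is chosen so that `-m z = ‖L‖ ‖θ‖` absorbs `L θ`.
  set m := -(‖L‖ / z * ‖θ‖)
  set n := 1 / 2 * ‖θ‖ ^ 2
  have i1 : Integrable (fun ω => Real.exp (m + n) * ((1 - m) * Z ω - Z ω * J θ ω)) P :=
    ((hZi.const_mul _).sub (integrable_weight_mul hZ (hJ.coeFn_toLpL hr θ))).const_mul _
  have h2 : ∫ ω, Real.exp (m + n) * ((1 - m) * Z ω - Z ω * J θ ω) ∂P =
      Real.exp (m + n) * ((1 - m) * z - L θ) := by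
    rw [integral_const_mul, integral_sub (hZi.const_mul _)
      (integrable_weight_mul hZ (hJ.coeFn_toLpL hr θ)), integral_const_mul, hL]
  calc z * Real.exp (n - ‖L‖ / z * ‖θ‖) = Real.exp (m + n) * z := by
        rw [mul_comm, sub_eq_neg_add]
    _ ≤ Real.exp (m + n) * ((1 - m) * z - L θ) := by
        gcongr
        have h3 : L θ ≤ ‖L‖ * ‖θ‖ := (le_abs_self _).trans (L.le_opNorm θ)
        have h4 : m * z = -(‖L‖ * ‖θ‖) := by
          simp only [m]
          field_simp
        nlinarith
    _ ≤ expectation J Z θ := by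
        rw [← h2]
        refine integral_mono i1 (hJ.integrable_expectation hs hZ θ) fun ω => ?_
        have h5 : -J θ ω + n = (m + n) + (-J θ ω - m) := by ring
        simp only [n] at h5 ⊢
        rw [h5, Real.exp_add _ (-J θ ω - m)]
        have h6 := mul_le_mul_of_nonneg_left (Real.add_one_le_exp (-J θ ω - m)) (hZ0 ω)
        have h7 := mul_le_mul_of_nonneg_left h6 (Real.exp_nonneg (m + 1 / 2 * ‖θ‖ ^ 2))
        linarith

lemma tendsto_expectation (hJ : IsSubgaussianMap J) (hs : 1 < s) (hZ : MemLp Z s P)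
    (hZ0 : ∀ ω, 0 ≤ Z ω) (hpos : 0 < P {ω | 0 < Z ω}) :
    Tendsto (expectation J Z) (comap (fun θ : H => ‖θ‖) atTop) atTop := by
  obtain ⟨z, hz, C, h⟩ := hJ.exists_le_expectation hs hZ hZ0 hpos
  refine tendsto_atTop_mono h ?_
  have h1 : Tendsto (fun x : ℝ => z * Real.exp (1 / 2 * x ^ 2 - C * x)) atTop atTop := by
    refine (Real.tendsto_exp_atTop.comp ?_).const_mul_atTop hz
    have : Tendsto (fun x : ℝ => x * (1 / 2 * x - C)) atTop atTop :=
      tendsto_id.atTop_mul_atTop₀ (tendsto_atTop_add_const_right _ (-C)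
        (tendsto_id.const_mul_atTop (by norm_num)))
    refine this.congr fun x => ?_
    ring
  exact h1.comp tendsto_comap

end IsSubgaussianMap

/-! ### Step functions in `L²([0, T], ℝ^q)` and their density. -/

section TimeMeasure

variable {T : ℝ}

instance isFiniteMeasure_timeMeasure : IsFiniteMeasure (timeMeasure T) := ⟨by
  rw [timeMeasure, (MeasurableEmbedding.subtype_coe measurableSet_Icc).comap_apply]
  refine (measure_mono (Set.image_subset_iff.2 fun x _ => x.2)).trans_lt
    (measure_Icc_lt_top (a := (0 : ℝ)) (b := T))⟩

lemma timeMeasure_Ioc (s t : TimeInterval T) :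
    timeMeasure T (Set.Ioc s t) = ENNReal.ofReal ((t : ℝ) - s) := by
  rw [timeMeasure, (MeasurableEmbedding.subtype_coe measurableSet_Icc).comap_apply,
    ← Real.volume_Ioc]
  congr 1
  ext x
  simp only [Set.mem_image, Set.mem_Ioc, Subtype.exists, exists_and_right, exists_eq_right]
  exact ⟨fun ⟨h, h1, h2⟩ => ⟨h1, h2⟩, fun ⟨h1, h2⟩ => ⟨⟨s.2.1.trans h1.le, h2.trans t.2.2⟩, h1, h2⟩⟩

lemma timeMeasure_singleton (t : TimeInterval T) : timeMeasure T {t} = 0 := by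
  rw [timeMeasure, (MeasurableEmbedding.subtype_coe measurableSet_Icc).comap_apply]
  simp

variable [Fact (0 ≤ T)]

/-- The initial time. -/
def initialTime (T : ℝ) [h : Fact (0 ≤ T)] : TimeInterval T := ⟨0, le_rfl, h.out⟩

lemma initialTime_le (t : TimeInterval T) : initialTime T ≤ t := t.2.1

variable {q : ℕ}

/-- The class of `1_{(0, t]} a` in `L²([0, T], ℝ^q)`. -/
noncomputable def timeIndicator (x : EuclideanSpace ℝ (Fin q) × TimeInterval T) : TimeL2 T q :=
  indicatorConstLp 2 (measurableSet_Ioc (a := initialTime T) (b := x.2)) (measure_ne_top _ _) x.1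

/-- The intervals `(0, s]` and `(0, t]` overlap in length `min s t`, which is the covariance kernel
of Brownian motion; compare `inner_innerLp`. -/
lemma inner_timeIndicator (x y : EuclideanSpace ℝ (Fin q) × TimeInterval T) :
    inner ℝ (timeIndicator x) (timeIndicator y) =
      min (x.2 : ℝ) (y.2 : ℝ) * inner ℝ x.1 y.1 := by
  rw [timeIndicator, timeIndicator, L2.inner_indicatorConstLp_indicatorConstLp, smul_eq_mul,
    Set.Ioc_inter_Ioc, sup_idem, measureReal_def, timeMeasure_Ioc]
  have h : ((min x.2 y.2 : TimeInterval T) : ℝ) = min (x.2 : ℝ) y.2 :=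
    (Subtype.mono_coe _).map_min
  rw [h, show ((initialTime T : TimeInterval T) : ℝ) = 0 from rfl, sub_zero,
    ENNReal.toReal_ofReal (le_min x.2.2.1 y.2.2.1)]

namespace StepFunction

/-- The class of a step function in `L²([0, T], ℝ^q)`. -/
noncomputable def toTimeL2 (h : StepFunction T q) : TimeL2 T q :=
  ∑ i, (timeIndicator (h.a i, h.t i.succ) - timeIndicator (h.a i, h.t i.castSucc))

lemma coeFn_timeIndicator_sub {s t : TimeInterval T} (hst : s ≤ t)
    (a : EuclideanSpace ℝ (Fin q)) :
    (timeIndicator (a, t) - timeIndicator (a, s) : TimeL2 T q) =ᵐ[timeMeasure T]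
      (Set.Ioc s t).indicator fun _ => a := by
  filter_upwards [Lp.coeFn_sub (timeIndicator (a, t)) (timeIndicator (a, s)),
    indicatorConstLp_coeFn (p := 2) (hs := measurableSet_Ioc (a := initialTime T) (b := t))
      (hμs := measure_ne_top (timeMeasure T) _) (c := a),
    indicatorConstLp_coeFn (p := 2) (hs := measurableSet_Ioc (a := initialTime T) (b := s))
      (hμs := measure_ne_top (timeMeasure T) _) (c := a)] with x h1 h2 h3
  rw [h1, Pi.sub_apply, timeIndicator, timeIndicator, h2, h3]
  have := (initialTime_le s).trans hst
  by_cases hx1 : x ≤ s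
  · have : ¬ s < x := hx1.not_gt
    simp [Set.indicator, hx1, hx1.trans hst, this]
  · have h4 : initialTime T < x := (initialTime_le s).trans_lt (not_le.1 hx1)
    simp [Set.indicator, hx1, not_le.1 hx1, h4]

lemma coeFn_toTimeL2 (h : StepFunction T q) : h.toTimeL2 =ᵐ[timeMeasure T] h.eval := by
  have h1 : ∀ i, (timeIndicator (h.a i, h.t i.succ) - timeIndicator (h.a i, h.t i.castSucc) :
      TimeL2 T q) =ᵐ[timeMeasure T] (Set.Ioc (h.t i.castSucc) (h.t i.succ)).indicator
        fun _ => h.a i :=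
    fun i => coeFn_timeIndicator_sub (h.monotone_t i.castSucc_lt_succ.le) _
  filter_upwards [ae_all_iff.2 h1, Lp.coeFn_fun_finsetSum Finset.univ (fun i =>
    timeIndicator (h.a i, h.t i.succ) - timeIndicator (h.a i, h.t i.castSucc))] with x h2 h3
  rw [toTimeL2, h3, StepFunction.eval]
  exact Finset.sum_congr rfl fun i _ => h2 i

/-- Cross terms vanish because the intervals are disjoint. The sum is the variance proxy produced by
independent increments in `hasSubgaussianMGF_sum`. -/
lemma norm_sq_toTimeL2 (h : StepFunction T q) :
    ‖h.toTimeL2‖ ^ 2 = ∑ i, ((h.t i.succ : ℝ) - h.t i.castSucc) * ‖h.a i‖ ^ 2 := by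
  have hlt : ∀ i j : Fin h.n, i < j →
      inner ℝ (timeIndicator (h.a i, h.t i.succ) - timeIndicator (h.a i, h.t i.castSucc) :
          TimeL2 T q)
        (timeIndicator (h.a j, h.t j.succ) - timeIndicator (h.a j, h.t j.castSucc)) = 0 := by
    intro i j hij
    have h1 : (h.t i.castSucc : ℝ) ≤ h.t i.succ := h.monotone_t i.castSucc_lt_succ.le
    have h2 : (h.t i.succ : ℝ) ≤ h.t j.castSucc := h.monotone_t (Fin.succ_le_castSucc_iff.2 hij)
    have h3 : (h.t j.castSucc : ℝ) ≤ h.t j.succ := h.monotone_t j.castSucc_lt_succ.le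
    simp only [inner_sub_left, inner_sub_right, inner_timeIndicator]
    rw [min_eq_left (h2.trans h3), min_eq_left h2, min_eq_left (h1.trans (h2.trans h3)),
      min_eq_left (h1.trans h2)]
    ring
  rw [← real_inner_self_eq_norm_sq, toTimeL2, sum_inner]
  refine Finset.sum_congr rfl fun i _ => ?_
  rw [inner_sum, Finset.sum_eq_single i]
  · have h1 : (h.t i.castSucc : ℝ) ≤ h.t i.succ := h.monotone_t i.castSucc_lt_succ.le
    simp only [inner_sub_left, inner_sub_right, inner_timeIndicator]
    rw [min_self, min_self, min_eq_left h1, min_eq_right h1, real_inner_self_eq_norm_sq]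
    ring
  · intro j _ hj
    rcases lt_or_gt_of_ne hj with hji | hij
    · rw [real_inner_comm]
      exact hlt j i hji
    · exact hlt i j hij
  · simp

omit [Fact (0 ≤ T)] in
lemma eval_eq (h : StepFunction T q) {s : TimeInterval T} {i : Fin h.n}
    (hs : s ∈ Set.Ioc (h.t i.castSucc) (h.t i.succ)) : h.eval s = h.a i := by
  rw [StepFunction.eval, Finset.sum_eq_single i, Set.indicator_of_mem hs]
  · intro j _ hj
    refine Set.indicator_of_notMem (fun hs' => ?_) _
    rcases lt_or_gt_of_ne hj with hji | hij
    · exact (hs'.2.trans (h.monotone_t (Fin.succ_le_castSucc_iff.2 hji))).not_gt hs.1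
    · exact (hs.2.trans (h.monotone_t (Fin.succ_le_castSucc_iff.2 hij))).not_gt hs'.1
  · simp

/-- By uniform continuity it is enough to sample `f` at the right endpoints of a grid of mesh `δ /
2`, clipped to `[0, T]`. The initial time is left out because no interval `(τ k, τ (k + 1)]`
contains it; it is a null set. -/
lemma exists_forall_dist_eval_le (f : C(TimeInterval T, EuclideanSpace ℝ (Fin q))) {ε : ℝ}
    (hε : 0 < ε) : ∃ h : StepFunction T q, ∀ s, s ≠ initialTime T → ‖h.eval s - f s‖ ≤ ε := by
  have hT : (0 : ℝ) ≤ T := Fact.out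
  obtain ⟨δ, hδ, hf⟩ := Metric.uniformContinuous_iff.1
    (CompactSpace.uniformContinuous_of_continuous f.continuous) ε hε
  obtain ⟨n, hn⟩ := exists_nat_ge (T / (δ / 2))
  rw [div_le_iff₀ (by positivity)] at hn
  set τ : ℕ → TimeInterval T := fun k => Set.projIcc 0 T hT (k * (δ / 2)) with hτ
  have hτm : Monotone τ := fun i j hij => Set.monotone_projIcc hT (by gcongr)
  have hτ0 : τ 0 = initialTime T := by
    simp only [hτ, Nat.cast_zero, zero_mul]
    exact Set.projIcc_left hT
  have hτn : ∀ s, s ≤ τ n := fun s => by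
    simp only [hτ, Set.projIcc_of_right_le hT hn]
    exact s.2.2
  refine ⟨⟨n, fun i => τ i, fun i j hij => hτm hij, fun i => f (τ (i + 1))⟩, fun s hs => ?_⟩
  have hex : ∃ k, s ≤ τ k := ⟨n, hτn s⟩
  classical
  obtain ⟨k, hk⟩ : ∃ k, Nat.find hex = k + 1 := by
    refine Nat.exists_eq_succ_of_ne_zero fun h0 => hs ?_
    have := Nat.find_spec hex
    rw [h0, hτ0] at this
    exact le_antisymm this (initialTime_le s)
  have h1 : s ≤ τ (k + 1) := hk ▸ Nat.find_spec hex
  have h2 : τ k < s := not_le.1 (Nat.find_min hex (by omega))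
  have hkn : k < n := by
    have := Nat.find_min' hex (hτn s)
    omega
  rw [eval_eq (i := ⟨k, hkn⟩) _ ⟨h2, h1⟩, ← dist_eq_norm]
  refine (hf ?_).le
  have h3 : ((τ (k + 1) : TimeInterval T) : ℝ) - τ k ≤ δ / 2 := by
    have h4 := Set.abs_projIcc_sub_projIcc (c := ((k + 1 : ℕ) : ℝ) * (δ / 2))
      (d := (k : ℝ) * (δ / 2)) hT
    refine (le_abs_self _).trans (h4.trans_eq ?_)
    push_cast
    rw [show ((k : ℝ) + 1) * (δ / 2) - k * (δ / 2) = δ / 2 by ring, abs_of_pos (by positivity)]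
  have h1' : (s : ℝ) ≤ τ (k + 1) := h1
  have h2' : ((τ k : TimeInterval T) : ℝ) < s := h2
  rw [Subtype.dist_eq, Real.dist_eq, abs_of_nonneg (by linarith)]
  linarith

lemma denseRange_toTimeL2 : DenseRange (toTimeL2 (T := T) (q := q)) := by
  refine fun θ => Metric.mem_closure_iff.2 fun ε hε => ?_
  obtain ⟨f, hf⟩ := (ContinuousMap.toLp_denseRange (EuclideanSpace ℝ (Fin q)) (timeMeasure T)
    (p := 2) ℝ (by simp)).exists_dist_lt θ (half_pos hε)
  set C : ℝ := measureUnivNNReal (timeMeasure T) ^ (2 : ℝ≥0∞).toReal⁻¹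
  have hC : 0 ≤ C := by positivity
  -- The denominator is `C + 1` because `C` vanishes when `T = 0`.
  have hη : 0 < ε / 2 / (C + 1) := by positivity
  obtain ⟨h, hh⟩ := exists_forall_dist_eval_le f hη
  refine ⟨h.toTimeL2, ⟨h, rfl⟩, ?_⟩
  have h1 : ‖ContinuousMap.toLp 2 (timeMeasure T) ℝ f - h.toTimeL2‖ ≤ C * (ε / 2 / (C + 1)) := by
    refine Lp.norm_le_of_ae_bound hη.le ?_
    filter_upwards [Lp.coeFn_sub (ContinuousMap.toLp 2 (timeMeasure T) ℝ f) h.toTimeL2,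
      ContinuousMap.coeFn_toLp (p := 2) (𝕜 := ℝ) (timeMeasure T) f, h.coeFn_toTimeL2,
      measure_eq_zero_iff_ae_notMem.1 (timeMeasure_singleton (initialTime T))] with s h2 h3 h4 h5
    rw [h2, Pi.sub_apply, h3, h4, norm_sub_rev]
    exact hh s h5
  have h2 : C * (ε / 2 / (C + 1)) ≤ ε / 2 := by
    rw [mul_div_assoc', div_le_iff₀ (by positivity)]
    nlinarith
  rw [← dist_eq_norm] at h1
  linarith [dist_triangle θ (ContinuousMap.toLp 2 (timeMeasure T) ℝ f) h.toTimeL2]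

end StepFunction

end TimeMeasure

/-! ### Gaussian vectors and Brownian increments. -/

/-- The covariance of two linear functionals of a centred isotropic Gaussian vector. -/
lemma integral_inner_mul_inner_multivariateGaussian {q : ℕ} {v : ℝ} (hv : 0 ≤ v)
    (a b : EuclideanSpace ℝ (Fin q)) :
    ∫ x, inner ℝ a x * inner ℝ b x ∂(multivariateGaussian 0 (v • (1 : Matrix (Fin q) (Fin q) ℝ))) =
      v * inner ℝ a b := by
  have h := covarianceBilin_multivariateGaussian (μ := 0) (Matrix.PosSemidef.one.smul hv :
    (v • (1 : Matrix (Fin q) (Fin q) ℝ)).PosSemidef) a b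
  rw [covarianceBilin_apply IsGaussian.memLp_two_id, integral_id_multivariateGaussian'] at h
  simp only [sub_zero] at h
  rw [h, Matrix.smul_mulVec, Matrix.one_mulVec, dotProduct_smul, smul_eq_mul]
  congr 1
  rw [PiLp.inner_apply, dotProduct]
  simp [mul_comm]

lemma integral_inner_multivariateGaussian {q : ℕ} (S : Matrix (Fin q) (Fin q) ℝ)
    (a : EuclideanSpace ℝ (Fin q)) : ∫ x, inner ℝ a x ∂(multivariateGaussian 0 S) = 0 := by
  rw [integral_inner (f := fun x : EuclideanSpace ℝ (Fin q) => x) IsGaussian.integrable_fun_id a,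
    integral_id_multivariateGaussian, inner_zero_right]

/-- A linear functional of the vector is a centred real Gaussian of variance `v ‖a‖²`, for which the
subgaussian bound is an equality. -/
lemma hasSubgaussianMGF_inner_multivariateGaussian {q : ℕ} {v : NNReal}
    (a : EuclideanSpace ℝ (Fin q)) :
    HasSubgaussianMGF (fun x => inner ℝ a x) (v * ‖a‖₊ ^ 2)
      (multivariateGaussian 0 ((v : ℝ) • (1 : Matrix (Fin q) (Fin q) ℝ))) := by
  set μ := multivariateGaussian 0 ((v : ℝ) • (1 : Matrix (Fin q) (Fin q) ℝ))
  have hm : μ.map (fun x => inner ℝ a x) = gaussianReal 0 (v * ‖a‖₊ ^ 2) := by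
    have h := IsGaussian.map_eq_gaussianReal (μ := μ) (innerSL ℝ a)
    have h0 := integral_inner_multivariateGaussian ((v : ℝ) • (1 : Matrix (Fin q) (Fin q) ℝ)) a
    have hc : ⇑(innerSL ℝ a) = fun x => inner ℝ a x := rfl
    rw [hc] at h
    rw [h, h0, variance_of_integral_eq_zero (by fun_prop) h0]
    have h1 := integral_inner_mul_inner_multivariateGaussian v.coe_nonneg a a
    simp only [← sq] at h1
    congr 1
    rw [h1, real_inner_self_eq_norm_sq]
    ext
    simp
    positivity
  refine HasSubgaussianMGF.congr_identDistrib (Y := fun x => inner ℝ a x) (X := id)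
    (μ := gaussianReal 0 (v * ‖a‖₊ ^ 2)) ?_ ?_
  · exact ⟨fun t => integrable_exp_mul_gaussianReal t, fun t => by
      rw [mgf_id_gaussianReal]; simp⟩
  · exact ⟨by fun_prop, by fun_prop, by rw [hm, Measure.map_id]⟩

namespace IsBrownianMotion

variable {Ω : Type*} {mΩ : MeasurableSpace Ω} {T : ℝ} {q : ℕ} {P : Measure Ω}
  {𝓕 : Filtration (TimeInterval T) mΩ} {W : TimeInterval T → Ω → EuclideanSpace ℝ (Fin q)}

lemma hasSubgaussianMGF_inner_sub (hW : IsBrownianMotion P 𝓕 W) {s t : TimeInterval T}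
    (hst : s ≤ t) (a : EuclideanSpace ℝ (Fin q)) :
    HasSubgaussianMGF (fun ω => inner ℝ a (W t ω - W s ω))
      (((t : ℝ) - s).toNNReal * ‖a‖₊ ^ 2) P := by
  have hl := hW.law_increment s t hst
  refine HasSubgaussianMGF.of_map (X := fun x => inner ℝ a x) hl.aemeasurable ?_
  rw [hl.map_eq]
  have h := hasSubgaussianMGF_inner_multivariateGaussian (v := ((t : ℝ) - s).toNNReal) a
  rwa [Real.coe_toNNReal _ (sub_nonneg.2 hst)] at h

lemma measurable_inner (hW : IsBrownianMotion P 𝓕 W) {s t : TimeInterval T} (hst : s ≤ t)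
    (a : EuclideanSpace ℝ (Fin q)) : Measurable[𝓕 t] (fun ω => inner ℝ a (W s ω)) :=
  Measurable.comp (by fun_prop) ((hW.adapted s).mono (𝓕.mono hst) le_rfl)

lemma indepFun_inner_sub (hW : IsBrownianMotion P 𝓕 W) {s t : TimeInterval T} (hst : s ≤ t)
    {Y : Ω → ℝ} (hY : Measurable[𝓕 s] Y) (a : EuclideanSpace ℝ (Fin q)) :
    IndepFun Y (fun ω => inner ℝ a (W t ω - W s ω)) P := by
  rw [IndepFun_iff_Indep]
  refine indep_of_indep_of_le_left (indep_of_indep_of_le_right (hW.indep_increment s t hst) ?_)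
    hY.comap_le
  rw [show (fun ω => inner ℝ a (W t ω - W s ω)) =
    (fun x => inner ℝ a x) ∘ fun ω => W t ω - W s ω from rfl, ← MeasurableSpace.comap_comp]
  exact MeasurableSpace.comap_mono (by fun_prop : Measurable fun x => inner ℝ a x).comap_le

/-- Induction on the number of increments: the earlier sum is measurable at the time when the last
increment starts, hence independent of it, and proxies of independent summands add up. -/
lemma hasSubgaussianMGF_sum (hW : IsBrownianMotion P 𝓕 W) [IsProbabilityMeasure P] (n : ℕ) :
    ∀ (t : Fin (n + 1) → TimeInterval T) (_ : Monotone t) (a : Fin n → EuclideanSpace ℝ (Fin q)),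
      HasSubgaussianMGF (fun ω => ∑ i, inner ℝ (a i) (W (t i.succ) ω - W (t i.castSucc) ω))
        (∑ i, ((t i.succ : ℝ) - t i.castSucc).toNNReal * ‖a i‖₊ ^ 2) P := by
  induction n with
  | zero => intro t _ a; simp
  | succ n ih =>
    intro t ht a
    have h1 := ih (fun i => t i.castSucc) (fun i j hij => ht (Fin.castSucc_le_castSucc_iff.2 hij))
      (fun i => a i.castSucc)
    have h2 := hW.hasSubgaussianMGF_inner_sub (ht (Fin.last n).castSucc_lt_succ.le) (a (Fin.last n))
    simp only [Fin.sum_univ_castSucc (n := n)]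
    refine h1.add_of_indepFun h2 (hW.indepFun_inner_sub (ht (Fin.last n).castSucc_lt_succ.le) ?_ _)
    refine Finset.measurable_fun_sum _ fun i _ => ?_
    simp only [inner_sub_right]
    exact (hW.measurable_inner (ht (Fin.castSucc_le_castSucc_iff.2 (Fin.le_last _))) _).sub
      (hW.measurable_inner (ht (Fin.castSucc_le_castSucc_iff.2 (Fin.le_last _))) _)

section Covariance

variable [Fact (0 ≤ T)]

lemma ae_sub_initialTime (hW : IsBrownianMotion P 𝓕 W) (t : TimeInterval T) :
    (fun ω => W t ω - W (initialTime T) ω) =ᵐ[P] W t := by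
  filter_upwards [hW.initial (initialTime T) rfl] with ω h
  rw [h, sub_zero]

lemma hasLaw (hW : IsBrownianMotion P 𝓕 W) (t : TimeInterval T) :
    HasLaw (W t) (multivariateGaussian 0 ((t : ℝ) • (1 : Matrix (Fin q) (Fin q) ℝ))) P := by
  have h := (hW.law_increment _ t (initialTime_le t)).congr (hW.ae_sub_initialTime t).symm
  rwa [show ((initialTime T : TimeInterval T) : ℝ) = 0 from rfl, sub_zero] at h

lemma memLp_inner (hW : IsBrownianMotion P 𝓕 W) (a : EuclideanSpace ℝ (Fin q))
    (t : TimeInterval T) : MemLp (fun ω => inner ℝ a (W t ω)) 2 P := by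
  refine MemLp.ae_eq ?_ ((hW.hasSubgaussianMGF_inner_sub (initialTime_le t) a).memLp 2)
  filter_upwards [hW.ae_sub_initialTime t] with ω h
  rw [h]

/-- Write `W t = W s + (W t - W s)`: the increment is centred and independent of `𝓕 s`, so only the
covariance at time `s` remains. -/
lemma integral_inner_mul_inner_of_le (hW : IsBrownianMotion P 𝓕 W) {s t : TimeInterval T}
    (hst : s ≤ t) (a b : EuclideanSpace ℝ (Fin q)) :
    ∫ ω, inner ℝ a (W s ω) * inner ℝ b (W t ω) ∂P = (s : ℝ) * inner ℝ a b := by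
  have h1 : ∫ ω, inner ℝ a (W s ω) * inner ℝ b (W s ω) ∂P = (s : ℝ) * inner ℝ a b := by
    rw [← integral_inner_mul_inner_multivariateGaussian s.2.1]
    exact (hW.hasLaw s).integral_comp (f := fun x => inner ℝ a x * inner ℝ b x) (by fun_prop)
  have hm := hW.memLp_inner
  have h2 : ∫ ω, inner ℝ a (W s ω) * inner ℝ b (W t ω - W s ω) ∂P = 0 := by
    have h := (hW.indepFun_inner_sub hst (hW.measurable_inner le_rfl a) b).integral_mul_eq_mul_integral
      (hm a s).1 (hW.hasSubgaussianMGF_inner_sub hst b).aestronglyMeasurable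
    have h3 : ∫ ω, inner ℝ b (W t ω - W s ω) ∂P = 0 := by
      rw [← integral_inner_multivariateGaussian
        (((t : ℝ) - (s : ℝ)) • (1 : Matrix (Fin q) (Fin q) ℝ)) b]
      exact (hW.law_increment s t hst).integral_comp (f := fun x => inner ℝ b x) (by fun_prop)
    rw [h3, mul_zero] at h
    exact h
  have h4 : ∀ ω, inner ℝ a (W s ω) * inner ℝ b (W t ω) = inner ℝ a (W s ω) * inner ℝ b (W s ω) +
      inner ℝ a (W s ω) * inner ℝ b (W t ω - W s ω) := fun ω => by
    rw [inner_sub_right]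
    ring
  have i1 : Integrable (fun ω => inner ℝ a (W s ω) * inner ℝ b (W s ω)) P :=
    (hm a s).integrable_mul (hm b s)
  have i2 : Integrable (fun ω => inner ℝ a (W s ω) * inner ℝ b (W t ω - W s ω)) P := by
    simp only [inner_sub_right]
    exact (hm a s).integrable_mul ((hm b t).sub (hm b s))
  simp_rw [h4]
  rw [integral_add i1 i2, h1, h2, add_zero]

/-- The class of `⟨a, W t⟩` in `L²(P)`. -/
noncomputable def innerLp (hW : IsBrownianMotion P 𝓕 W)
    (x : EuclideanSpace ℝ (Fin q) × TimeInterval T) : Lp ℝ 2 P :=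
  (hW.memLp_inner x.1 x.2).toLp

lemma inner_innerLp (hW : IsBrownianMotion P 𝓕 W)
    (x y : EuclideanSpace ℝ (Fin q) × TimeInterval T) :
    inner ℝ (hW.innerLp x) (hW.innerLp y) = min (x.2 : ℝ) (y.2 : ℝ) * inner ℝ x.1 y.1 := by
  have h : inner ℝ (hW.innerLp x) (hW.innerLp y) =
      ∫ ω, inner ℝ x.1 (W x.2 ω) * inner ℝ y.1 (W y.2 ω) ∂P := by
    rw [L2.inner_def]
    refine integral_congr_ae ?_
    filter_upwards [(hW.memLp_inner x.1 x.2).coeFn_toLp, (hW.memLp_inner y.1 y.2).coeFn_toLp]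
      with ω h1 h2
    rw [innerLp, innerLp, h1, h2, RCLike.inner_apply, conj_trivial, mul_comm]
  rw [h]
  rcases le_total x.2 y.2 with hxy | hxy
  · rw [hW.integral_inner_mul_inner_of_le hxy, min_eq_left (show (x.2 : ℝ) ≤ y.2 from hxy)]
  · simp_rw [mul_comm (inner ℝ x.1 _)]
    rw [hW.integral_inner_mul_inner_of_le hxy, min_eq_right (show (y.2 : ℝ) ≤ x.2 from hxy),
      real_inner_comm]

end Covariance

end IsBrownianMotion

/-! ### The Wiener integral as a subgaussian isometric extension. -/

/-- The squared norm of a combination depends only on the Gram matrix. Applied to `innerLp` and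
`timeIndicator`, this is the Itô isometry for deterministic integrands. -/
lemma norm_linearCombination_eq_of_inner_eq {ι E F : Type*} [NormedAddCommGroup E]
    [InnerProductSpace ℝ E] [NormedAddCommGroup F] [InnerProductSpace ℝ F] {u : ι → E} {v : ι → F}
    (h : ∀ i j, inner ℝ (u i) (u j) = inner ℝ (v i) (v j)) (x : ι →₀ ℝ) :
    ‖Finsupp.linearCombination ℝ u x‖ = ‖Finsupp.linearCombination ℝ v x‖ := by
  rw [← sq_eq_sq₀ (norm_nonneg _) (norm_nonneg _), ← real_inner_self_eq_norm_sq,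
    ← real_inner_self_eq_norm_sq]
  simp only [Finsupp.linearCombination_apply, Finsupp.sum_inner, Finsupp.inner_sum,
    real_inner_smul_left, real_inner_smul_right, h]

/-- Subgaussianity passes to limits in `L²(P)`. -/
lemma hasSubgaussianMGF_of_tendsto {Ω : Type*} {mΩ : MeasurableSpace Ω} {P : Measure Ω}
    {f : ℕ → Lp ℝ 2 P} {g : Lp ℝ 2 P} (hfg : Tendsto f atTop (𝓝 g)) {c : ℕ → NNReal} {c' : NNReal}
    (hc : Tendsto c atTop (𝓝 c')) (hf : ∀ n, HasSubgaussianMGF (f n) (c n) P) :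
    HasSubgaussianMGF g c' P := by
  obtain ⟨ns, hns, hlim⟩ := (tendstoInMeasure_of_tendsto_Lp hfg).exists_seq_tendsto_ae
  -- Fatou's lemma along an almost surely convergent subsequence. With lower integrals, this one
  -- bound yields both the integrability of `exp (t g)` and the estimate of its mean.
  have key : ∀ t : ℝ, ∫⁻ ω, ENNReal.ofReal (Real.exp (t * g ω)) ∂P ≤
      ENNReal.ofReal (Real.exp (c' * t ^ 2 / 2)) := by
    intro t
    have hlim' : Tendsto (fun n => ENNReal.ofReal (Real.exp (c (ns n) * t ^ 2 / 2))) atTop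
        (𝓝 (ENNReal.ofReal (Real.exp (c' * t ^ 2 / 2)))) := by
      refine ENNReal.tendsto_ofReal ((Real.continuous_exp.tendsto _).comp ?_)
      exact (((NNReal.tendsto_coe.2 (hc.comp hns.tendsto_atTop)).mul_const _).div_const _)
    calc ∫⁻ ω, ENNReal.ofReal (Real.exp (t * g ω)) ∂P
        = ∫⁻ ω, liminf (fun n => ENNReal.ofReal (Real.exp (t * f (ns n) ω))) atTop ∂P := by
          refine lintegral_congr_ae ?_
          filter_upwards [hlim] with ω hω
          refine (Tendsto.liminf_eq ?_).symm
          exact ENNReal.tendsto_ofReal ((Real.continuous_exp.tendsto _).comp (hω.const_mul t))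
      _ ≤ liminf (fun n => ∫⁻ ω, ENNReal.ofReal (Real.exp (t * f (ns n) ω)) ∂P) atTop :=
          lintegral_liminf_le' fun n =>
            ((hf (ns n)).integrable_exp_mul t).1.aemeasurable.ennreal_ofReal
      _ ≤ liminf (fun n => ENNReal.ofReal (Real.exp (c (ns n) * t ^ 2 / 2))) atTop := by
          refine liminf_le_liminf (Eventually.of_forall fun n => ?_)
          rw [← ofReal_integral_eq_lintegral_ofReal ((hf (ns n)).integrable_exp_mul t)
            (Eventually.of_forall fun _ => Real.exp_nonneg _)]
          exact ENNReal.ofReal_le_ofReal ((hf (ns n)).mgf_le t)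
      _ = _ := hlim'.liminf_eq
  have hm : ∀ t : ℝ, AEStronglyMeasurable (fun ω => Real.exp (t * g ω)) P := fun t =>
    Real.continuous_exp.comp_aestronglyMeasurable ((Lp.aestronglyMeasurable g).const_mul t)
  refine ⟨fun t => ⟨hm t, ?_⟩, fun t => ?_⟩
  · rw [hasFiniteIntegral_iff_ofReal (Eventually.of_forall fun _ => Real.exp_nonneg _)]
    exact (key t).trans_lt ENNReal.ofReal_lt_top
  · rw [mgf, integral_eq_lintegral_of_nonneg_ae (Eventually.of_forall fun _ => Real.exp_nonneg _)
      (hm t)]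
    exact ENNReal.toReal_le_of_le_ofReal (Real.exp_nonneg _) (key t)

namespace IsBrownianMotion

variable {Ω : Type*} {mΩ : MeasurableSpace Ω} {T : ℝ} {q : ℕ} {P : Measure Ω}
  {𝓕 : Filtration (TimeInterval T) mΩ} {W : TimeInterval T → Ω → EuclideanSpace ℝ (Fin q)}
  [Fact (0 ≤ T)]

/-- The formal combination of indicators of intervals `(0, t]` that represents a step function. -/
noncomputable def _root_.StepFunction.toFinsupp (h : StepFunction T q) :
    EuclideanSpace ℝ (Fin q) × TimeInterval T →₀ ℝ :=
  ∑ i, (Finsupp.single (h.a i, h.t i.succ) 1 - Finsupp.single (h.a i, h.t i.castSucc) 1)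

omit [Fact (0 ≤ T)] in
lemma _root_.StepFunction.linearCombination_toFinsupp {M : Type*} [AddCommGroup M] [Module ℝ M]
    (h : StepFunction T q) (u : EuclideanSpace ℝ (Fin q) × TimeInterval T → M) :
    Finsupp.linearCombination ℝ u h.toFinsupp =
      ∑ i, (u (h.a i, h.t i.succ) - u (h.a i, h.t i.castSucc)) := by
  simp [StepFunction.toFinsupp]

lemma denseRange_linearCombination :
    DenseRange (Finsupp.linearCombination ℝ (timeIndicator (T := T) (q := q))) := by
  refine StepFunction.denseRange_toTimeL2.mono ?_
  rintro _ ⟨h, rfl⟩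
  exact ⟨h.toFinsupp, h.linearCombination_toFinsupp _⟩

/-- The Wiener integral, as a continuous linear map from `L²([0, T], ℝ^q)` to `L²(P)`. -/
noncomputable def wienerL (hW : IsBrownianMotion P 𝓕 W) : TimeL2 T q →L[ℝ] Lp ℝ 2 P :=
  (Finsupp.linearCombination ℝ hW.innerLp).extendOfNorm
    (Finsupp.linearCombination ℝ (timeIndicator (T := T) (q := q)))

lemma wienerL_toTimeL2 (hW : IsBrownianMotion P 𝓕 W) (h : StepFunction T q) :
    hW.wienerL h.toTimeL2 =
      ∑ i, (hW.innerLp (h.a i, h.t i.succ) - hW.innerLp (h.a i, h.t i.castSucc)) := by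
  rw [← h.linearCombination_toFinsupp hW.innerLp, StepFunction.toTimeL2,
    ← h.linearCombination_toFinsupp timeIndicator, wienerL]
  -- On formal combinations nothing has to be checked about well-definedness: the norm bound, with
  -- constant `1` by equality of Gram matrices, provides it.
  refine LinearMap.extendOfNorm_eq denseRange_linearCombination ⟨1, fun x => ?_⟩ _
  rw [one_mul]
  refine (norm_linearCombination_eq_of_inner_eq (fun i j => ?_) x).le
  rw [hW.inner_innerLp, inner_timeIndicator]

lemma coeFn_wienerL_toTimeL2 (hW : IsBrownianMotion P 𝓕 W) (h : StepFunction T q) :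
    hW.wienerL h.toTimeL2 =ᵐ[P] h.integral W := by
  rw [hW.wienerL_toTimeL2]
  have h1 : ∀ i, (hW.innerLp (h.a i, h.t i.succ) - hW.innerLp (h.a i, h.t i.castSucc) :
      Lp ℝ 2 P) =ᵐ[P] fun ω => inner ℝ (h.a i) (W (h.t i.succ) ω - W (h.t i.castSucc) ω) := by
    intro i
    filter_upwards [Lp.coeFn_sub (hW.innerLp (h.a i, h.t i.succ))
        (hW.innerLp (h.a i, h.t i.castSucc)), (hW.memLp_inner (h.a i) (h.t i.succ)).coeFn_toLp,
      (hW.memLp_inner (h.a i) (h.t i.castSucc)).coeFn_toLp] with ω h1 h2 h3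
    rw [h1, Pi.sub_apply, innerLp, innerLp, h2, h3, inner_sub_right]
  filter_upwards [ae_all_iff.2 h1, Lp.coeFn_fun_finsetSum Finset.univ (fun i =>
    hW.innerLp (h.a i, h.t i.succ) - hW.innerLp (h.a i, h.t i.castSucc))] with ω h2 h3
  rw [h3, StepFunction.integral]
  exact Finset.sum_congr rfl fun i _ => h2 i

lemma exists_tendsto_toTimeL2 (θ : TimeL2 T q) :
    ∃ h : ℕ → StepFunction T q, Tendsto (fun n => (h n).toTimeL2) atTop (𝓝 θ) := by
  obtain ⟨x, hx, hlim⟩ := mem_closure_iff_seq_limit.1 (StepFunction.denseRange_toTimeL2 θ)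
  choose h hh using hx
  exact ⟨h, by simpa only [hh] using hlim⟩

/-- For a step function the proxy from independent increments is exactly the squared norm, so it
converges along an approximating sequence. -/
lemma isSubgaussianMap_wienerL [IsProbabilityMeasure P] (hW : IsBrownianMotion P 𝓕 W) :
    IsSubgaussianMap hW.wienerL := by
  intro θ
  obtain ⟨h, hlim⟩ := exists_tendsto_toTimeL2 θ
  refine hasSubgaussianMGF_of_tendsto ((hW.wienerL.continuous.tendsto θ).comp hlim)
    (hlim.nnnorm.pow 2) fun n => ?_
  refine HasSubgaussianMGF.congr ?_ (hW.coeFn_wienerL_toTimeL2 (h n)).symm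
  have h1 := hW.hasSubgaussianMGF_sum (h n).n (h n).t (h n).monotone_t (h n).a
  convert! h1 using 1
  rw [← NNReal.coe_inj]
  push_cast
  rw [StepFunction.norm_sq_toTimeL2]
  refine Finset.sum_congr rfl fun i _ => ?_
  have hle : ((h n).t i.castSucc : ℝ) ≤ (h n).t i.succ := (h n).monotone_t i.castSucc_lt_succ.le
  rw [Real.coe_toNNReal _ (sub_nonneg.2 hle)]

lemma tendsto_toTimeL2_iff (h : ℕ → StepFunction T q) (θ : TimeL2 T q) :
    Tendsto (fun n => (h n).toTimeL2) atTop (𝓝 θ) ↔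
      Tendsto (fun n => eLpNorm (fun s => (h n).eval s - θ s) 2 (timeMeasure T)) atTop (𝓝 0) := by
  rw [Lp.tendsto_Lp_iff_tendsto_eLpNorm']
  refine iff_of_eq (congrArg (fun u => Tendsto u atTop (𝓝 0)) (funext fun n => ?_))
  refine eLpNorm_congr_ae ?_
  filter_upwards [(h n).coeFn_toTimeL2] with s hs
  rw [Pi.sub_apply, hs]

lemma tendsto_wienerL_iff (hW : IsBrownianMotion P 𝓕 W) (h : ℕ → StepFunction T q) {Y : Ω → ℝ}
    (hY : MemLp Y 2 P) :
    Tendsto (fun n => hW.wienerL (h n).toTimeL2) atTop (𝓝 hY.toLp) ↔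
      Tendsto (fun n => eLpNorm (fun ω => (h n).integral W ω - Y ω) 2 P) atTop (𝓝 0) := by
  rw [Lp.tendsto_Lp_iff_tendsto_eLpNorm']
  refine iff_of_eq (congrArg (fun u => Tendsto u atTop (𝓝 0)) (funext fun n => ?_))
  refine eLpNorm_congr_ae ?_
  filter_upwards [hW.coeFn_wienerL_toTimeL2 (h n), hY.coeFn_toLp] with ω h1 h2
  rw [Pi.sub_apply, h1, h2]

/-- Continuity of `wienerL` forces every admissible limit of step integrals to be its value, and
density of step functions supplies a sequence for the converse. Existence and almost sure uniqueness
of the Wiener integral follow. -/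
lemma isWienerIntegral_iff (hW : IsBrownianMotion P 𝓕 W) (θ : TimeL2 T q) (Y : Ω → ℝ) :
    IsWienerIntegral P W θ Y ↔ Y =ᵐ[P] hW.wienerL θ := by
  constructor
  · rintro ⟨hY, h, h1, h2⟩
    rw [← tendsto_toTimeL2_iff] at h1
    rw [← hW.tendsto_wienerL_iff h hY] at h2
    rw [← tendsto_nhds_unique h2 ((hW.wienerL.continuous.tendsto θ).comp h1)]
    exact hY.coeFn_toLp.symm
  · intro hYθ
    have hY : MemLp Y 2 P := (memLp_congr_ae hYθ).2 (Lp.memLp _)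
    obtain ⟨h, hlim⟩ := exists_tendsto_toTimeL2 θ
    refine ⟨hY, h, (tendsto_toTimeL2_iff h θ).1 hlim, (hW.tendsto_wienerL_iff h hY).1 ?_⟩
    rw [show hY.toLp = hW.wienerL θ from Lp.ext (hY.coeFn_toLp.trans hYθ)]
    exact (hW.wienerL.continuous.tendsto θ).comp hlim

lemma wienerIntegral_ae_eq (hW : IsBrownianMotion P 𝓕 W) (θ : TimeL2 T q) :
    wienerIntegral P W θ =ᵐ[P] hW.wienerL θ := by
  have hex : ∃ Y : Ω → ℝ, IsWienerIntegral P W θ Y :=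
    ⟨_, (hW.isWienerIntegral_iff θ _).2 EventuallyEq.rfl⟩
  rw [wienerIntegral, dif_pos hex]
  exact (hW.isWienerIntegral_iff θ _).1 hex.choose_spec

lemma girsanovPhi_ae_eq (hW : IsBrownianMotion P 𝓕 W) (θ : TimeL2 T q) :
    girsanovPhi P W θ =ᵐ[P] fun ω => -hW.wienerL θ ω + 1 / 2 * ‖θ‖ ^ 2 := by
  filter_upwards [hW.wienerIntegral_ae_eq θ] with ω h
  rw [girsanovPhi, h]

omit [Fact (0 ≤ T)] in
lemma _root_.girsanovD2Phi_eq_inner (ψ φ : TimeL2 T q) : girsanovD2Phi ψ φ = inner ℝ φ ψ :=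
  (L2.inner_def φ ψ).symm

lemma girsanovDPhi_ae_eq (hW : IsBrownianMotion P 𝓕 W) (θ ψ : TimeL2 T q) :
    girsanovDPhi P W θ ψ =ᵐ[P] fun ω => -hW.wienerL ψ ω + inner ℝ θ ψ := by
  filter_upwards [hW.wienerIntegral_ae_eq ψ] with ω h
  rw [girsanovDPhi, h, L2.inner_def]

lemma girsanovQ_eq (hW : IsBrownianMotion P 𝓕 W) {d : ℕ} (F : PathSpace T d → ℝ)
    (X : Ω → PathSpace T d) :
    girsanovQ P W F X = IsSubgaussianMap.expectation hW.wienerL fun ω => F (X ω) ^ 2 := by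
  refine funext fun θ => integral_congr_ae ?_
  filter_upwards [hW.girsanovPhi_ae_eq θ] with ω h
  rw [h]

end IsBrownianMotion

/-! ### The weight `F²(X)` and the conclusion. -/

lemma memLp_sq_of_integrable_rpow_abs {Ω : Type*} {mΩ : MeasurableSpace Ω} {P : Measure Ω}
    {f : Ω → ℝ} {δ : ℝ} (hδ : 0 < δ) (h : Integrable (fun ω => |f ω| ^ (2 + δ)) P) :
    MemLp (fun ω => f ω ^ 2) (ENNReal.ofReal (1 + δ / 2)) P := by
  have hm : AEStronglyMeasurable (fun ω => f ω ^ 2) P := by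
    -- Measurability of `f ^ 2` is read off from that of `|f| ^ (2 + δ)` by taking the power `2 / (2
    -- + δ)`.
    refine ((h.1.aemeasurable.pow_const (2 / (2 + δ))).congr
      (Eventually.of_forall fun ω => ?_)).aestronglyMeasurable
    have : (|f ω| ^ (2 + δ)) ^ (2 / (2 + δ)) = f ω ^ 2 := by
      rw [← Real.rpow_mul (abs_nonneg _), mul_div_cancel₀ _ (by positivity : 2 + δ ≠ 0),
        Real.rpow_two, sq_abs]
    exact this
  have hp : ENNReal.ofReal (1 + δ / 2) ≠ 0 := (ENNReal.ofReal_pos.2 (by positivity)).ne'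
  refine (integrable_norm_rpow_iff hm hp ENNReal.ofReal_ne_top).1 (h.congr
    (Eventually.of_forall fun ω => ?_))
  have : |f ω| ^ (2 + δ) = ‖f ω ^ 2‖ ^ (ENNReal.ofReal (1 + δ / 2)).toReal := by
    rw [ENNReal.toReal_ofReal (by positivity), norm_pow, Real.norm_eq_abs, ← Real.rpow_two,
      ← Real.rpow_mul (abs_nonneg _)]
    ring_nf
  exact this

theorem proposition2p5 {Ω : Type*} {mΩ : MeasurableSpace Ω} (P : Measure Ω)
    [IsProbabilityMeasure P] (T : ℝ) [Fact (0 ≤ T)] (q d : ℕ)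
    (𝓕 : Filtration (TimeInterval T) mΩ)
    (W : TimeInterval T → Ω → EuclideanSpace ℝ (Fin q)) (hW : IsBrownianMotion P 𝓕 W)
    (b : TimeInterval T → PathSpace T d → EuclideanSpace ℝ (Fin d))
    (σ : TimeInterval T → PathSpace T d →
      (EuclideanSpace ℝ (Fin q) →L[ℝ] EuclideanSpace ℝ (Fin d)))
    (hbσ : IsAdmissibleCoefficients b σ)
    (x₀ : EuclideanSpace ℝ (Fin d)) (X : Ω → PathSpace T d)
    (hX : IsSolution P 𝓕 W b σ x₀ X)
    (F : PathSpace T d → ℝ) (hF : Measurable F)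
    (δ : ℝ) (hδ : 0 < δ)
    (hmoment : Integrable (fun ω => |F (X ω)| ^ (2 + δ)) P)
    (hpos : 0 < P {ω | 0 < F (X ω) ^ 2}) :
    -- `Q` is finite, strictly convex and coercive, also along finite-dimensional subspaces
    (∀ θ : TimeL2 T q, Integrable (fun ω => F (X ω) ^ 2 * Real.exp (girsanovPhi P W θ ω)) P) ∧
    StrictConvexOn ℝ Set.univ (girsanovQ P W F X) ∧
    Tendsto (girsanovQ P W F X) (comap (fun θ : TimeL2 T q => ‖θ‖) atTop) atTop ∧
    (∀ E : Submodule ℝ (TimeL2 T q), FiniteDimensional ℝ E →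
      Tendsto (girsanovQ P W F X)
        (comap (fun θ : TimeL2 T q => ‖θ‖) atTop ⊓ 𝓟 (E : Set (TimeL2 T q))) atTop) ∧
    -- `Q` is twice Fréchet differentiable, with its first and second differentials
    (∀ θ : TimeL2 T q, DifferentiableAt ℝ (girsanovQ P W F X) θ ∧
      DifferentiableAt ℝ (fderiv ℝ (girsanovQ P W F X)) θ) ∧
    (∀ θ ψ : TimeL2 T q,
      Integrable (fun ω => F (X ω) ^ 2 * Real.exp (girsanovPhi P W θ ω) *
        girsanovDPhi P W θ ψ ω) P ∧
      fderiv ℝ (girsanovQ P W F X) θ ψ =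
        ∫ ω, F (X ω) ^ 2 * Real.exp (girsanovPhi P W θ ω) * girsanovDPhi P W θ ψ ω ∂P) ∧
    (∀ θ ψ φ : TimeL2 T q,
      Integrable (fun ω => F (X ω) ^ 2 * Real.exp (girsanovPhi P W θ ω) *
        (girsanovDPhi P W θ ψ ω * girsanovDPhi P W θ φ ω + girsanovD2Phi ψ φ)) P ∧
      fderiv ℝ (fderiv ℝ (girsanovQ P W F X)) θ ψ φ =
        ∫ ω, F (X ω) ^ 2 * Real.exp (girsanovPhi P W θ ω) *
          (girsanovDPhi P W θ ψ ω * girsanovDPhi P W θ φ ω + girsanovD2Phi ψ φ) ∂P) ∧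
    -- `Φ` is twice Fréchet differentiable into `L^r(P)`, for every finite `r ≥ 1`, with its
    -- first and second differentials
    (∀ (r : ℝ≥0∞) [Fact (1 ≤ r)], r ≠ ∞ → ∃ Φ : TimeL2 T q → Lp ℝ r P,
      (∀ θ, Φ θ =ᵐ[P] girsanovPhi P W θ) ∧
      (∀ θ, DifferentiableAt ℝ Φ θ ∧ DifferentiableAt ℝ (fderiv ℝ Φ) θ) ∧
      (∀ θ ψ, fderiv ℝ Φ θ ψ =ᵐ[P] girsanovDPhi P W θ ψ) ∧
      (∀ θ ψ φ, fderiv ℝ (fderiv ℝ Φ) θ ψ φ =ᵐ[P] fun _ => girsanovD2Phi ψ φ)) := by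
  have hJ := hW.isSubgaussianMap_wienerL
  have hs : 1 < ENNReal.ofReal (1 + δ / 2) := by
    rw [ENNReal.one_lt_ofReal]
    linarith
  have hZ := memLp_sq_of_integrable_rpow_abs hδ hmoment
  have hZ0 : ∀ ω, 0 ≤ F (X ω) ^ 2 := fun ω => sq_nonneg _
  have hQ := hW.girsanovQ_eq F X
  have hcoercive : Tendsto (girsanovQ P W F X) (comap (fun θ : TimeL2 T q => ‖θ‖) atTop) atTop := by
    rw [hQ]
    exact hJ.tendsto_expectation hs hZ hZ0 hpos
  -- Coercivity holds on the whole space, so along a subspace it is just a restriction of the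
  -- filter.
  refine ⟨fun θ => ?_, ?_, hcoercive, fun E _ => hcoercive.mono_left inf_le_left, fun θ => ?_,
    fun θ ψ => ?_, fun θ ψ φ => ?_, fun r _ hr => ?_⟩
  · refine (hJ.integrable_expectation hs hZ θ).congr ?_
    filter_upwards [hW.girsanovPhi_ae_eq θ] with ω h
    rw [h]
  · rw [hQ]
    exact hJ.strictConvexOn_expectation hs hZ hZ0 hpos
  · rw [hQ]
    exact hJ.differentiableAt_expectation hs hZ θ
  · have h1 := hJ.fderiv_expectation hs hZ θ ψ
    have h2 : (fun ω => F (X ω) ^ 2 * (Real.exp (-hW.wienerL θ ω + 1 / 2 * ‖θ‖ ^ 2) *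
        (-hW.wienerL ψ ω + inner ℝ θ ψ))) =ᵐ[P] fun ω =>
        F (X ω) ^ 2 * Real.exp (girsanovPhi P W θ ω) * girsanovDPhi P W θ ψ ω := by
      filter_upwards [hW.girsanovPhi_ae_eq θ, hW.girsanovDPhi_ae_eq θ ψ] with ω h3 h4
      rw [h3, h4, mul_assoc]
    rw [hQ, h1.2]
    exact ⟨h1.1.congr h2, integral_congr_ae h2⟩
  · have h1 := hJ.fderiv_fderiv_expectation hs hZ θ ψ φ
    have h2 : (fun ω => F (X ω) ^ 2 * (Real.exp (-hW.wienerL θ ω + 1 / 2 * ‖θ‖ ^ 2) *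
        ((-hW.wienerL ψ ω + inner ℝ θ ψ) * (-hW.wienerL φ ω + inner ℝ θ φ) + inner ℝ φ ψ))) =ᵐ[P]
        fun ω => F (X ω) ^ 2 * Real.exp (girsanovPhi P W θ ω) *
          (girsanovDPhi P W θ ψ ω * girsanovDPhi P W θ φ ω + girsanovD2Phi ψ φ) := by
      filter_upwards [hW.girsanovPhi_ae_eq θ, hW.girsanovDPhi_ae_eq θ ψ,
        hW.girsanovDPhi_ae_eq θ φ] with ω h3 h4 h5
      rw [h3, h4, h5, girsanovD2Phi_eq_inner, mul_assoc]
    rw [hQ, h1.2]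
    exact ⟨h1.1.congr h2, integral_congr_ae h2⟩
  · have hd : fderiv ℝ (hJ.phiLp hr) = hJ.dphiLp hr :=
      funext fun θ => (hJ.hasFDerivAt_phiLp hr θ).fderiv
    refine ⟨hJ.phiLp hr, fun θ => ?_, fun θ => ⟨?_, ?_⟩, fun θ ψ => ?_, fun θ ψ φ => ?_⟩
    · exact (hJ.coeFn_phiLp hr θ).trans (hW.girsanovPhi_ae_eq θ).symm
    · exact (hJ.hasFDerivAt_phiLp hr θ).differentiableAt
    · rw [hd]
      exact (hJ.hasFDerivAt_dphiLp hr θ).differentiableAt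
    · rw [hd]
      exact (hJ.coeFn_dphiLp hr θ ψ).trans (hW.girsanovDPhi_ae_eq θ ψ).symm
    · rw [hd, (hJ.hasFDerivAt_dphiLp hr θ).fderiv, girsanovD2Phi_eq_inner, real_inner_comm]
      exact IsSubgaussianMap.coeFn_innerOneL ψ φ
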